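/- Let $V$ be a separable real Hilbert space, let $\tfrac12<\beta<\beta'<\beta''<H<1$ and $\mu>0$, and let $Q$ be a positive symmetric trace class operator on $V$. Let $C_0(\mathbb R,V)$ be the space of continuous paths $\omega:\mathbb R\to V$ with $\omega(0)=0$, with the topology of uniform convergence on compact sets and its Borel $\sigma$-algebra, let $P$ be the law on $C_0(\mathbb R,V)$ of the $V$-valued fractional Brownian motion with Hurst parameter $H$ and covariance operator $Q$ (the centered Gaussian process with $E\langle x,\omega(s)\rangle\langle y,\omega(t)\rangle=\tfrac12(|t|^{2H}+|s|^{2H}-|t-s|^{2H})\langle Qx,y\rangle$), and let $\theta_t\omega(\cdot)=\omega(t+\cdot)-\omega(t)$. For $\gamma>0$ and $a\le b$ put $$|||\omega|||_{\gamma,a,b}=\sup_{a\le s<t\le b}\frac{|\omega(t)-\omega(s)|}{(t-s)^{\gamma}}\in[0,\infty].$$ Define $$T(\omega)=\inf\{\tau>0:|||\omega|||_{\beta',0,\tau}+\mu\tau^{1-\beta'}\ge\mu\},\qquad \hat T(\omega)=\sup\{\tau<0:|||\omega|||_{\beta',\tau,0}+\mu|\tau|^{1-\beta'}\ge\mu\},$$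 and $(T_i(\omega))_{i\in\mathbb Z}$ by $T_0=0$, $T_i(\omega)=T_{i-1}(\omega)+T(\theta_{T_{i-1}(\omega)}\omega)$ for $i>0$ and $T_i(\omega)=T_{i+1}(\omega)+\hat T(\theta_{T_{i+1}(\omega)}\omega)$ for $i<0$. Put $$F(\omega)=\Big(\frac{\sup_{r\in[0,1]}|||\theta_r\omega|||_{\beta'',-1,0}+\mu}{\mu}\Big)^{\frac1{\beta''-\beta'}},\qquad d^{-1}=E_P F.$$ Let $\Omega$ be the set of all $\omega\in C_0(\mathbb R,V)$ such that $\omega$ is $\beta''$-Hölder continuous on every interval $[-k,k]$, $k\in\mathbb N$, such that $\lim_{t\to\pm\infty}\frac1t\int_0^tF(\theta_q\omega)\,dq=E_PF$, and such that $\lim_{t\to\pm\infty}\frac1{|t|}\sup_{r\in[0,1]}|||\theta_{t+r}\omega|||_{\beta'',-1,0}=0$. Then $\Omega$ is a Borel set, $\theta_t^{-1}\Omega=\Omega$ for all $t\in\mathbb R$, and $P(\Omega)=1$; moreover $E_PF<\infty$, so $d>0$; and for every $\omega\in\Omega$ $$\liminf_{k\to-\infty}\frac{T_k(\omega)}{k}\ge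 d>0,$$ $T(\theta_{T_i(\omega)}\omega)>0$ for all $i\in\mathbb Z$, and $|T(\theta_{T_i(\omega)}\omega)|^{-\beta}$ is subexponentially growing as $i\to-\infty$: $$\lim_{i\to-\infty}\frac{\log^+\big(|T(\theta_{T_i(\omega)}\omega)|^{-\beta}\big)}{|i|}=0.$$ -/

import Mathlib

open MeasureTheory ProbabilityTheory Filter Set
open scoped Topology ENNReal

namespace FBMStopping

/-- The path space `C₀(ℝ, V)`: continuous functions `ℝ → V` vanishing at `0`. -/
def PathSpace (V : Type*) [NormedAddCommGroup V] : Type _ :=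
  {ω : C(ℝ, V) // ω 0 = 0}

section Paths

variable {V : Type*} [NormedAddCommGroup V]

/-- The topology of uniform convergence on compact sets (compact-open topology). -/
instance : TopologicalSpace (PathSpace V) :=
  inferInstanceAs (TopologicalSpace {ω : C(ℝ, V) // ω 0 = 0})

/-- The Borel σ-algebra `𝓑(C₀(ℝ, V))`. -/
instance : MeasurableSpace (PathSpace V) := borel _

instance : BorelSpace (PathSpace V) := ⟨rfl⟩

instance : CoeFun (PathSpace V) (fun _ => ℝ → V) := ⟨fun ω => ω.1⟩

/-- The shift `θ_t ω (s) = ω (t + s) - ω t`. -/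
def shift (t : ℝ) (ω : PathSpace V) : PathSpace V :=
  ⟨⟨fun s => ω (t + s) - ω t,
    (ω.1.continuous.comp (continuous_const.add continuous_id)).sub continuous_const⟩,
    by simp⟩

/-- The Hölder seminorm `|||ω|||_{γ,a,b} = sup_{a ≤ s < t ≤ b} |ω t - ω s| / (t - s)^γ`,
with values in `[0, ∞]`. -/
noncomputable def holderSeminorm (γ a b : ℝ) (ω : PathSpace V) : ℝ≥0∞ :=
  ⨆ (s : ℝ) (t : ℝ) (_ : a ≤ s ∧ s < t ∧ t ≤ b), ‖ω t - ω s‖ₑ / ENNReal.ofReal ((t - s) ^ γ)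

/-- The forward time `T(ω) = inf {τ > 0 : |||ω|||_{γ,0,τ} + μ τ^{1-γ} ≥ μ}`.
The set contains `τ = 1` for every path. -/
noncomputable def forwardTime (γ μ : ℝ) (ω : PathSpace V) : ℝ :=
  sInf {τ : ℝ | 0 < τ ∧
    ENNReal.ofReal μ ≤ holderSeminorm γ 0 τ ω + ENNReal.ofReal (μ * τ ^ (1 - γ))}

/-- The backward time `T̂(ω) = sup {τ < 0 : |||ω|||_{γ,τ,0} + μ |τ|^{1-γ} ≥ μ}`.
The set contains `τ = -1` for every path. -/
noncomputable def backwardTime (γ μ : ℝ) (ω : PathSpace V) : ℝ :=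
  sSup {τ : ℝ | τ < 0 ∧
    ENNReal.ofReal μ ≤ holderSeminorm γ τ 0 ω + ENNReal.ofReal (μ * |τ| ^ (1 - γ))}

/-- `T_n`, `n ≥ 0`: `T_0 = 0`, `T_{n+1}(ω) = T_n(ω) + T(θ_{T_n(ω)} ω)`. -/
noncomputable def forwardSeq (γ μ : ℝ) (ω : PathSpace V) : ℕ → ℝ
  | 0 => 0
  | n + 1 => forwardSeq γ μ ω n + forwardTime γ μ (shift (forwardSeq γ μ ω n) ω)

/-- `T_{-n}`, `n ≥ 0`: `T_0 = 0`, `T_{-(n+1)}(ω) = T_{-n}(ω) + T̂(θ_{T_{-n}(ω)} ω)`. -/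
noncomputable def backwardSeq (γ μ : ℝ) (ω : PathSpace V) : ℕ → ℝ
  | 0 => 0
  | n + 1 => backwardSeq γ μ ω n + backwardTime γ μ (shift (backwardSeq γ μ ω n) ω)

/-- The two-sided sequence of stopping times `(T_i(ω))_{i ∈ ℤ}`. -/
noncomputable def stoppingTime (γ μ : ℝ) (i : ℤ) (ω : PathSpace V) : ℝ :=
  if 0 ≤ i then forwardSeq γ μ ω i.toNat else backwardSeq γ μ ω (-i).toNat

theorem stoppingTime_zero (γ μ : ℝ) (ω : PathSpace V) : stoppingTime γ μ 0 ω = 0 := by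
  simp [stoppingTime, forwardSeq]

theorem stoppingTime_of_pos (γ μ : ℝ) (ω : PathSpace V) (i : ℤ) (hi : 0 < i) :
    stoppingTime γ μ i ω = stoppingTime γ μ (i - 1) ω +
      forwardTime γ μ (shift (stoppingTime γ μ (i - 1) ω) ω) := by
  obtain ⟨n, rfl⟩ : ∃ n : ℕ, i = n + 1 := ⟨(i - 1).toNat, by omega⟩
  have h : ((n : ℤ) + 1).toNat = n + 1 := by omega
  have h' : (0 : ℤ) ≤ (n : ℤ) + 1 := by omega
  simp [stoppingTime, h, h', forwardSeq]

theorem stoppingTime_of_neg (γ μ : ℝ) (ω : PathSpace V) (i : ℤ) (hi : i < 0) :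
    stoppingTime γ μ i ω = stoppingTime γ μ (i + 1) ω +
      backwardTime γ μ (shift (stoppingTime γ μ (i + 1) ω) ω) := by
  obtain ⟨n, rfl⟩ : ∃ n : ℕ, i = -((n : ℤ) + 1) := ⟨(-i - 1).toNat, by omega⟩
  have h1 : ¬ (0 : ℤ) ≤ -((n : ℤ) + 1) := by omega
  have h2 : (-(-((n : ℤ) + 1))).toNat = n + 1 := by omega
  have h3 : -((n : ℤ) + 1) + 1 = -(n : ℤ) := by ring
  rw [h3]
  have h4 : stoppingTime γ μ (-(n : ℤ)) ω = backwardSeq γ μ ω n := by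
    rcases Nat.eq_zero_or_pos n with rfl | hn
    · simp [stoppingTime, forwardSeq, backwardSeq]
    · have : ¬ (0 : ℤ) ≤ -(n : ℤ) := by omega
      simp only [stoppingTime, this, if_false]
      congr 1
      omega
  rw [h4]
  simp only [stoppingTime, h1, if_false, h2, backwardSeq]

/-- `sup_{r ∈ [0,1]} |||θ_r ω|||_{γ,-1,0}`. -/
noncomputable def windowSeminorm (γ : ℝ) (ω : PathSpace V) : ℝ≥0∞ :=
  ⨆ (r : ℝ) (_ : r ∈ Icc (0 : ℝ) 1), holderSeminorm γ (-1) 0 (shift r ω)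

/-- `((sup_{r ∈ [0,1]} |||θ_r ω|||_{β'',-1,0} + μ) / μ)^{1 / (β'' - β')}`. -/
noncomputable def holderFunctional (β' β'' μ : ℝ) (ω : PathSpace V) : ℝ≥0∞ :=
  ((windowSeminorm β'' ω + ENNReal.ofReal μ) / ENNReal.ofReal μ) ^ (1 / (β'' - β'))

/-- The expectation of `holderFunctional`, whose reciprocal is the rate `d`. -/
noncomputable def holderMean (β' β'' μ : ℝ) (P : Measure (PathSpace V)) : ℝ≥0∞ :=
  ∫⁻ ω, holderFunctional β' β'' μ ω ∂P

/-- The rate `d`, defined by `1 / d = E_P (holderFunctional)`. -/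
noncomputable def rate (β' β'' μ : ℝ) (P : Measure (PathSpace V)) : ℝ :=
  (holderMean β' β'' μ P).toReal⁻¹

/-- The paths that are `γ`-Hölder continuous on every interval `[-k, k]`. -/
def holderPaths (γ : ℝ) : Set (PathSpace V) :=
  {ω | ∀ k : ℕ, holderSeminorm γ (-(k : ℝ)) k ω < ∞}

/-- The paths along which the time averages of `holderFunctional` converge, in both time
directions, to its expectation. -/
def ergodicPaths (β' β'' μ : ℝ) (P : Measure (PathSpace V)) : Set (PathSpace V) :=
  {ω | ∀ l ∈ ({atTop, atBot} : Set (Filter ℝ)),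
    Tendsto (fun t : ℝ => 1 / t * ∫ q in (0 : ℝ)..t, (holderFunctional β' β'' μ (shift q ω)).toReal)
      l (𝓝 (holderMean β' β'' μ P).toReal)}

/-- The paths along which `t ↦ sup_{r ∈ [0,1]} |||θ_{t+r} ω|||_{γ,-1,0}` grows sublinearly,
in both time directions. -/
def sublinearPaths (γ : ℝ) : Set (PathSpace V) :=
  {ω | ∀ l ∈ ({atTop, atBot} : Set (Filter ℝ)),
    Tendsto (fun t : ℝ => windowSeminorm γ (shift t ω) / ENNReal.ofReal |t|) l (𝓝 0)}

/-- The set `Ω` of good paths. -/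
def goodPaths (β' β'' μ : ℝ) (P : Measure (PathSpace V)) : Set (PathSpace V) :=
  ergodicPaths β' β'' μ P ∩ sublinearPaths β'' ∩ holderPaths β''

end Paths

section FBM

variable {V : Type*} [NormedAddCommGroup V] [InnerProductSpace ℝ V]

/-- A positive operator of trace class on a Hilbert space: positive (in particular symmetric)
with `∑ ⟪Q e, e⟫ < ∞` over an orthonormal basis. -/
def IsPositiveTraceClass (Q : V →L[ℝ] V) : Prop :=
  Q.IsPositive ∧ ∃ (w : Set V) (e : HilbertBasis w ℝ V),
    Summable fun i => inner ℝ (Q (e i)) (e i)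

/-- `P` is the law on `C₀(ℝ, V)` of a fractional Brownian motion with values in `V`, Hurst
parameter `H` and covariance operator `Q`: under `P` the coordinate process is jointly Gaussian,
centered, and
`E ⟪x, ω s⟫ ⟪y, ω t⟫ = (1/2) (|t|^{2H} + |s|^{2H} - |t - s|^{2H}) ⟪Q x, y⟫`. -/
structure IsFBMLaw (H : ℝ) (Q : V →L[ℝ] V) (P : Measure (PathSpace V)) : Prop where
  gaussian : IsGaussianProcess (fun (p : ℝ × V) (ω : PathSpace V) => inner ℝ p.2 (ω p.1)) P
  centered : ∀ (t : ℝ) (x : V), ∫ ω : PathSpace V, inner ℝ x (ω t) ∂P = 0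
  covariance_eq : ∀ (s t : ℝ) (x y : V),
    cov[fun ω : PathSpace V => inner ℝ x (ω s), fun ω : PathSpace V => inner ℝ y (ω t); P] =
      1 / 2 * (|t| ^ (2 * H) + |s| ^ (2 * H) - |t - s| ^ (2 * H)) * inner ℝ (Q x) y

end FBM

end FBMStopping

/-! The pathwise claims rest on one inequality. On an interval of length `x ≤ 1` the `β'`-seminorm
is at most `x ^ (β'' - β')` times the `β''`-seminorm, and `x ^ (1 - β') ≤ x ^ (β'' - β')`. Reaching
the threshold `μ` therefore forces `x ≥ 1 / F` (`inv_growth_le`), where `F` is evaluated at any time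
`q` whose window covers the relevant unit interval. A backward step ending at `u` has length at most
1, so every `q` inside the step satisfies `u ∈ [q, q + 1]` and `F (θ_q ω)` is at least the inverse
of the step length. Thus `F` has integral at least 1 over each step
(`one_le_integral_backwardTime`), and summing gives `|k| ≤ ∫ F` over `[T_k, 0]`. Local integrability
of `F` yields `T_k → -∞`, and the ergodic limit of the time averages turns the inequality into
`liminf T_k / k ≥ d`. For the waiting times, `T (θ_{T_i} ω) ≥ 1 / F (θ_{T_i} ω)`; since `|T_i| ≤
|i|` and the window seminorm is sublinear, `F` grows at most polynomially in `|i|`, so its logarithm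
is `o(|i|)`.

The probabilistic work is `P Ω = 1`. Linear functionals of the path are centered Gaussian, so their
characteristic functions depend only on variances. Stationarity of increments gives invariance of
`P`. For `H < 1` the covariance of a functional with its far shift tends to zero; with the mean
ergodic theorem this yields ergodicity of the unit shift (`IsFBMLaw.ergodic_shift_one`), and the
pointwise ergodic theorem is proved by a maximal-function argument. Integrability of `F` comes from
self-similar increments, Fernique's theorem and dyadic chaining, which give high moments of the
Hölder seminorms for exponents below `H`. The same moments, summed over integer times, give
sublinear growth.

For measurability, the real-time limits defining `Ω` are replaced by limits along integers
(`goodPaths_eq`). -/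

namespace FBMStopping

/-! ### Topology and measurability on path space. -/

section PathTopology

variable {V : Type*} [NormedAddCommGroup V]

instance [TopologicalSpace.SeparableSpace V] : SecondCountableTopology (PathSpace V) := by
  have := UniformSpace.secondCountable_of_separable V
  exact TopologicalSpace.Subtype.secondCountableTopology {ω : C(ℝ, V) | ω 0 = 0}

/-- Polishness makes injective measurable maps to countable products measurable embeddings, as
needed in `measure_ext_of_linearFunctionals`. -/
instance [TopologicalSpace.SeparableSpace V] [CompleteSpace V] : PolishSpace (PathSpace V) := by
  have := UniformSpace.secondCountable_of_separable V
  have : PolishSpace C(ℝ, V) := inferInstance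
  exact (isClosed_eq (ContinuousEvalConst.continuous_eval_const 0) continuous_const :
    IsClosed {ω : C(ℝ, V) | ω 0 = 0}).polishSpace

/-- Evaluation is jointly continuous. -/
theorem continuous_eval_path : Continuous fun p : PathSpace V × ℝ => p.1 p.2 :=
  (continuous_eval (F := C(ℝ, V))).comp
    ((continuous_subtype_val.comp continuous_fst).prodMk continuous_snd)

theorem continuous_path (ω : PathSpace V) : Continuous (ω : ℝ → V) := ω.1.continuous

theorem continuous_apply_path (t : ℝ) : Continuous fun ω : PathSpace V => ω t :=
  continuous_eval_path.comp (continuous_id.prodMk continuous_const)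

theorem path_ext {ω ω' : PathSpace V} (h : ∀ t, ω t = ω' t) : ω = ω' :=
  Subtype.ext (ContinuousMap.ext h)

@[simp] theorem path_zero (ω : PathSpace V) : ω 0 = 0 := ω.2

@[simp] theorem shift_apply (t s : ℝ) (ω : PathSpace V) : shift t ω s = ω (t + s) - ω t := rfl

theorem shift_shift (s t : ℝ) (ω : PathSpace V) : shift s (shift t ω) = shift (t + s) ω :=
  path_ext fun u => by simp [add_assoc]

@[simp] theorem shift_zero (ω : PathSpace V) : shift 0 ω = ω :=
  path_ext fun u => by simp

theorem continuous_shift_uncurry : Continuous fun p : ℝ × PathSpace V => shift p.1 p.2 := by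
  refine Continuous.subtype_mk (ContinuousMap.continuous_of_continuous_uncurry _ ?_) _
  refine Continuous.sub (f := fun q : (ℝ × PathSpace V) × ℝ => q.1.2 (q.1.1 + q.2))
    (g := fun q : (ℝ × PathSpace V) × ℝ => q.1.2 q.1.1) ?_ ?_
  · exact continuous_eval_path.comp (by fun_prop :
      Continuous fun q : (ℝ × PathSpace V) × ℝ => (q.1.2, q.1.1 + q.2))
  · exact continuous_eval_path.comp (by fun_prop :
      Continuous fun q : (ℝ × PathSpace V) × ℝ => (q.1.2, q.1.1))

theorem continuous_shift (t : ℝ) : Continuous (shift t : PathSpace V → PathSpace V) :=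
  continuous_shift_uncurry.comp (continuous_const.prodMk continuous_id)

theorem continuous_shift_left (ω : PathSpace V) : Continuous fun t => shift t ω :=
  continuous_shift_uncurry.comp (continuous_id.prodMk continuous_const)

theorem measurable_shift (t : ℝ) : Measurable (shift t : PathSpace V → PathSpace V) :=
  (continuous_shift t).measurable

/-- A supremum of continuous functions is lower semicontinuous even over an uncountable family; this
is the source of measurability for all the seminorms. -/
theorem lowerSemicontinuous_holderSeminorm (γ a b : ℝ) :
    LowerSemicontinuous (holderSeminorm γ a b : PathSpace V → ℝ≥0∞) := by
  refine lowerSemicontinuous_iSup fun s => lowerSemicontinuous_iSup fun t =>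
    lowerSemicontinuous_iSup fun h => Continuous.lowerSemicontinuous ?_
  have h0 : ENNReal.ofReal ((t - s) ^ γ) ≠ 0 := by
    have : 0 < (t - s) ^ γ := Real.rpow_pos_of_pos (by linarith [h.2.1]) _
    simpa using this
  exact (ENNReal.continuous_div_const _ h0).comp
    (((continuous_apply_path t).sub (continuous_apply_path s)).enorm)

theorem lowerSemicontinuous_windowSeminorm (γ : ℝ) :
    LowerSemicontinuous (windowSeminorm γ : PathSpace V → ℝ≥0∞) :=
  lowerSemicontinuous_iSup fun r => lowerSemicontinuous_iSup fun _ =>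
    (lowerSemicontinuous_holderSeminorm γ (-1) 0).comp (continuous_shift r)

theorem measurable_holderSeminorm (γ a b : ℝ) :
    Measurable (holderSeminorm γ a b : PathSpace V → ℝ≥0∞) :=
  (lowerSemicontinuous_holderSeminorm γ a b).measurable

theorem measurable_windowSeminorm (γ : ℝ) :
    Measurable (windowSeminorm γ : PathSpace V → ℝ≥0∞) :=
  (lowerSemicontinuous_windowSeminorm γ).measurable

theorem measurable_holderFunctional (β' β'' μ : ℝ) :
    Measurable (holderFunctional β' β'' μ : PathSpace V → ℝ≥0∞) :=
  (((measurable_windowSeminorm β'').add_const _).div_const _).pow_const _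

theorem measurable_shift_uncurry [TopologicalSpace.SeparableSpace V] :
    Measurable fun p : ℝ × PathSpace V => shift p.1 p.2 :=
  continuous_shift_uncurry.measurable

end PathTopology

/-! ### Hölder seminorms under shifts and changes of interval. -/

section PathAlgebra

variable {V : Type*} [NormedAddCommGroup V]

theorem enorm_sub_le_of_mem {γ a b s t : ℝ} (ω : PathSpace V) (h : a ≤ s ∧ s < t ∧ t ≤ b) :
    ‖ω t - ω s‖ₑ / ENNReal.ofReal ((t - s) ^ γ) ≤ holderSeminorm γ a b ω :=
  le_iSup_of_le s <| le_iSup_of_le t <| le_iSup_of_le h le_rfl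

theorem holderSeminorm_mono {γ a b a' b' : ℝ} (ω : PathSpace V) (ha : a' ≤ a) (hb : b ≤ b') :
    holderSeminorm γ a b ω ≤ holderSeminorm γ a' b' ω :=
  iSup_le fun _ => iSup_le fun _ => iSup_le fun h =>
    enorm_sub_le_of_mem ω ⟨ha.trans h.1, h.2.1, h.2.2.trans hb⟩

theorem holderSeminorm_shift (γ a b r : ℝ) (ω : PathSpace V) :
    holderSeminorm γ a b (shift r ω) = holderSeminorm γ (r + a) (r + b) ω := by
  refine le_antisymm ?_ ?_
  · refine iSup_le fun s => iSup_le fun t => iSup_le fun h => ?_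
    refine le_trans (le_of_eq ?_) (enorm_sub_le_of_mem (γ := γ) (s := r + s) (t := r + t) ω
      ⟨by linarith [h.1], by linarith [h.2.1], by linarith [h.2.2]⟩)
    simp
  · refine iSup_le fun s => iSup_le fun t => iSup_le fun h => ?_
    refine le_trans (le_of_eq ?_) (enorm_sub_le_of_mem (γ := γ) (s := s - r) (t := t - r)
      (shift r ω) ⟨by linarith [h.1], by linarith [h.2.1], by linarith [h.2.2]⟩)
    simp

theorem windowSeminorm_shift (γ q : ℝ) (ω : PathSpace V) :
    windowSeminorm γ (shift q ω) =
      ⨆ (r : ℝ) (_ : r ∈ Icc (0 : ℝ) 1), holderSeminorm γ (q + r - 1) (q + r) ω := by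
  simp only [windowSeminorm, shift_shift, holderSeminorm_shift, add_zero, sub_eq_add_neg]

theorem windowSeminorm_shift_le (γ q : ℝ) (ω : PathSpace V) :
    windowSeminorm γ (shift q ω) ≤ holderSeminorm γ (q - 1) (q + 1) ω := by
  rw [windowSeminorm_shift]
  exact iSup_le fun r => iSup_le fun hr =>
    holderSeminorm_mono ω (by linarith [hr.1]) (by linarith [hr.2])

theorem windowSeminorm_le (γ : ℝ) (ω : PathSpace V) :
    windowSeminorm γ ω ≤ holderSeminorm γ (-1) 1 ω := by
  simpa using windowSeminorm_shift_le γ 0 ω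

/-- This is the purpose of the supremum over `r` in `F`: one value at time `q` controls all unit
intervals whose right end lies in `[q, q + 1]`. -/
theorem le_windowSeminorm_shift {γ q u : ℝ} (ω : PathSpace V) (h : u ∈ Icc q (q + 1)) :
    holderSeminorm γ (u - 1) u ω ≤ windowSeminorm γ (shift q ω) := by
  rw [windowSeminorm_shift]
  refine le_iSup_of_le (u - q) (le_iSup_of_le ⟨by linarith [h.1], by linarith [h.2]⟩ ?_)
  simp

/-- The window seminorm at a real time is controlled by those at the neighbouring integers. -/
theorem windowSeminorm_shift_le_max {γ q n : ℝ} (ω : PathSpace V) (h : q ∈ Icc n (n + 1)) :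
    windowSeminorm γ (shift q ω) ≤
      max (windowSeminorm γ (shift n ω)) (windowSeminorm γ (shift (n + 1) ω)) := by
  rw [windowSeminorm_shift γ q]
  refine iSup_le fun r => iSup_le fun hr => ?_
  rcases le_total (q + r) (n + 1) with h' | h'
  · exact (le_windowSeminorm_shift ω ⟨by linarith [h.1, hr.1], h'⟩).trans (le_max_left _ _)
  · exact (le_windowSeminorm_shift ω ⟨h', by linarith [h.2, hr.2]⟩).trans (le_max_right _ _)

end PathAlgebra

/-! ### The pointwise ergodic theorem. -/

section Birkhoff

variable {X : Type*} {T : X → X} {g : X → ℝ}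

/-- The running maximum `max (0, S₁, …, Sₙ)` of the Birkhoff sums of `g`. -/
noncomputable def birkhoffMax (T : X → X) (g : X → ℝ) : ℕ → X → ℝ
  | 0 => 0
  | n + 1 => fun x => max 0 (g x + birkhoffMax T g n (T x))

theorem birkhoffMax_nonneg (n : ℕ) (x : X) : 0 ≤ birkhoffMax T g n x := by
  cases n with
  | zero => exact le_rfl
  | succ n => exact le_max_left _ _

theorem birkhoffMax_le_succ (n : ℕ) : ∀ x, birkhoffMax T g n x ≤ birkhoffMax T g (n + 1) x := by
  induction n with
  | zero => exact fun x => birkhoffMax_nonneg 1 x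
  | succ n ih => exact fun x => max_le_max le_rfl (add_le_add le_rfl (ih (T x)))

theorem birkhoffMax_monotone (x : X) : Monotone fun n => birkhoffMax T g n x :=
  monotone_nat_of_le_succ fun n => birkhoffMax_le_succ n x

theorem birkhoffSum_le_birkhoffMax (n : ℕ) : ∀ x, birkhoffSum T g n x ≤ birkhoffMax T g n x := by
  induction n with
  | zero => intro x; simp [birkhoffMax]
  | succ n ih =>
    intro x
    rw [birkhoffSum_succ']
    exact (add_le_add le_rfl (ih (T x))).trans (le_max_right _ _)

variable [MeasurableSpace X] {ν : Measure X}

theorem measurable_birkhoffMax (hT : Measurable T) (hg : Measurable g) (n : ℕ) :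
    Measurable (birkhoffMax T g n) := by
  induction n with
  | zero => exact measurable_const
  | succ n ih => exact measurable_const.max (hg.add (ih.comp hT))

theorem integrable_birkhoffMax (hT : MeasurePreserving T ν ν) (hg : Integrable g ν) (n : ℕ) :
    Integrable (birkhoffMax T g n) ν := by
  induction n with
  | zero => exact integrable_zero _ _ _
  | succ n ih =>
    have := (integrable_zero X ℝ ν).sup (hg.add (hT.integrable_comp_of_integrable ih))
    exact this

/-- For an ergodic map and an integrand of negative mean, the Birkhoff sums are bounded above. -/
theorem ae_bddAbove_birkhoffMax [IsProbabilityMeasure ν] (hT : Ergodic T ν) (hm : Measurable g)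
    (hg : Integrable g ν) (hneg : ∫ x, g x ∂ν < 0) :
    ∀ᵐ x ∂ν, BddAbove (range fun n => birkhoffMax T g n x) := by
  set A : Set X := {x | Tendsto (fun n => birkhoffMax T g n x) atTop atTop} with hA
  have hbdd : ∀ x, x ∉ A → BddAbove (range fun n => birkhoffMax T g n x) := fun x hx => by
    by_contra h
    exact hx (tendsto_atTop_atTop_of_monotone' (birkhoffMax_monotone x) h)
  have hAm : MeasurableSet A := by
    have : A = ⋂ k : ℕ, ⋃ n : ℕ, {x | (k : ℝ) ≤ birkhoffMax T g n x} := by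
      ext x
      simp only [hA, mem_ofPred_eq, mem_iInter, mem_iUnion]
      constructor
      · exact fun h k => (h.eventually_ge_atTop (k : ℝ)).exists
      · refine fun h => tendsto_atTop_atTop_of_monotone (birkhoffMax_monotone x) fun b => ?_
        obtain ⟨k, hk⟩ := exists_nat_ge b
        obtain ⟨n, hn⟩ := h k
        exact ⟨n, hk.trans hn⟩
    rw [this]
    exact .iInter fun k => .iUnion fun n =>
      measurableSet_le measurable_const (measurable_birkhoffMax hT.measurable hm n)
  -- The maximum of order `n + 1` at `x` lies between `g x` and `|g x|` plus the maximum of order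
  -- `n` at `T x`, so both diverge together.
  have hinv : T ⁻¹' A = A := by
    ext x
    simp only [hA, mem_preimage, mem_ofPred_eq]
    rw [← tendsto_add_atTop_iff_nat (f := fun n => birkhoffMax T g n x) 1]
    simp only [birkhoffMax]
    constructor
    · intro h
      exact tendsto_atTop_mono (fun n => le_max_right _ _) (tendsto_atTop_add_const_left _ (g x) h)
    · intro h
      refine tendsto_atTop_mono (fun n => ?_) (tendsto_atTop_add_const_right _ (-|g x|) h)
      have h0 : 0 ≤ birkhoffMax T g n (T x) := birkhoffMax_nonneg n (T x)
      have : max 0 (g x + birkhoffMax T g n (T x)) ≤ |g x| + birkhoffMax T g n (T x) :=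
        max_le (by positivity) (by linarith [le_abs_self (g x)])
      linarith
  rcases hT.toPreErgodic.ae_mem_or_ae_notMem hAm hinv with h | h
  swap
  · filter_upwards [h] with x hx using hbdd x hx
  -- With `M n` the running maximum, `M (n + 1) - M n ∘ T = max (-(M n ∘ T)) g`. Its integral is
  -- nonnegative by invariance and monotonicity in `n`. If `M n → ∞` almost everywhere, the right
  -- side tends to `g` under the bound `|g|`, contradicting the negative mean.
  · exfalso
    have hlim : Tendsto (fun n => ∫ x, max (-birkhoffMax T g n (T x)) (g x) ∂ν) atTop
        (𝓝 (∫ x, g x ∂ν)) := by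
      refine tendsto_integral_of_dominated_convergence (fun x => |g x|) (fun n => ?_) hg.abs
        (fun n => ?_) ?_
      · exact ((((measurable_birkhoffMax hT.measurable hm n).comp hT.measurable).neg).max
          hm).aestronglyMeasurable
      · refine .of_forall fun x => ?_
        rw [Real.norm_eq_abs, abs_le]
        have h0 : 0 ≤ birkhoffMax T g n (T x) := birkhoffMax_nonneg n (T x)
        exact ⟨(neg_abs_le _).trans (le_max_right _ _),
          max_le (by linarith [abs_nonneg (g x)]) (le_abs_self _)⟩
      · filter_upwards [h] with x hx
        have hx' : Tendsto (fun n => birkhoffMax T g n (T x)) atTop atTop := by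
          rw [← hinv] at hx; exact hx
        refine tendsto_const_nhds.congr' ?_
        filter_upwards [hx'.eventually_ge_atTop (-g x)] with n hn
        exact (max_eq_right (by linarith)).symm
    have hge : ∀ n, 0 ≤ ∫ x, max (-birkhoffMax T g n (T x)) (g x) ∂ν := fun n => by
      have hMi := integrable_birkhoffMax hT.toMeasurePreserving hg
      have hcomp : ∫ x, birkhoffMax T g n (T x) ∂ν = ∫ x, birkhoffMax T g n x ∂ν := by
        have h1 := integral_map (μ := ν) hT.measurable.aemeasurable
          (f := birkhoffMax T g n)
          (measurable_birkhoffMax hT.measurable hm n).aestronglyMeasurable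
        rw [hT.map_eq] at h1
        exact h1.symm
      have heq : ∀ x, max (-birkhoffMax T g n (T x)) (g x) =
          birkhoffMax T g (n + 1) x - birkhoffMax T g n (T x) := fun x => by
        simp only [birkhoffMax]
        rw [max_sub_sub_right 0 _ _ |>.symm]
        simp
      simp_rw [heq]
      have hMT : Integrable (fun x => birkhoffMax T g n (T x)) ν :=
        hT.toMeasurePreserving.integrable_comp_of_integrable (hMi n)
      rw [integral_sub (hMi (n + 1)) hMT, hcomp, sub_nonneg]
      exact integral_mono (hMi n) (hMi (n + 1)) (birkhoffMax_le_succ n)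
    exact absurd (ge_of_tendsto' hlim hge) (not_le.2 hneg)

/-- Centering at `c'` strictly between the mean and `c` gives bounded sums, and the slack `(c - c')
* n` absorbs the bound. -/
theorem ae_eventually_birkhoffSum_le [IsProbabilityMeasure ν] (hT : Ergodic T ν)
    (hm : Measurable g) (hg : Integrable g ν) {c : ℝ} (hc : ∫ x, g x ∂ν < c) :
    ∀ᵐ x ∂ν, ∀ᶠ n : ℕ in atTop, birkhoffSum T g n x / n ≤ c := by
  obtain ⟨c', hc1, hc2⟩ := exists_between hc
  have hneg : ∫ x, (g x - c') ∂ν < 0 := by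
    rw [integral_sub hg (integrable_const _)]
    simpa using hc1
  filter_upwards [ae_bddAbove_birkhoffMax hT (hm.sub_const c') (hg.sub (integrable_const c')) hneg]
    with x hx
  obtain ⟨B, hB⟩ := hx
  have h1 : Tendsto (fun n : ℕ => (c - c') * n) atTop atTop :=
    tendsto_natCast_atTop_atTop.const_mul_atTop (by linarith)
  filter_upwards [h1.eventually_ge_atTop B, eventually_gt_atTop 0] with n hn hn0
  have h2 : birkhoffSum T (fun x => g x - c') n x ≤ B :=
    (birkhoffSum_le_birkhoffMax n x).trans (hB ⟨n, rfl⟩)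
  have h3 : birkhoffSum T (fun x => g x - c') n x = birkhoffSum T g n x - n * c' := by
    simp [birkhoffSum, Finset.sum_sub_distrib]
  rw [div_le_iff₀ (by exact_mod_cast hn0)]
  nlinarith

/-- **Birkhoff's pointwise ergodic theorem** for ergodic maps. -/
theorem ae_tendsto_birkhoffSum_div [IsProbabilityMeasure ν] (hT : Ergodic T ν)
    (hm : Measurable g) (hg : Integrable g ν) :
    ∀ᵐ x ∂ν, Tendsto (fun n : ℕ => birkhoffSum T g n x / n) atTop (𝓝 (∫ x, g x ∂ν)) := by
  have hup : ∀ᵐ x ∂ν, ∀ k : ℕ, ∀ᶠ n : ℕ in atTop,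
      birkhoffSum T g n x / n ≤ ∫ x, g x ∂ν + 1 / (k + 1) :=
    ae_all_iff.2 fun k => ae_eventually_birkhoffSum_le hT hm hg
      (lt_add_of_pos_right _ Nat.one_div_pos_of_nat)
  have hlo : ∀ᵐ x ∂ν, ∀ k : ℕ, ∀ᶠ n : ℕ in atTop,
      birkhoffSum T (-g) n x / n ≤ -∫ x, g x ∂ν + 1 / (k + 1) :=
    ae_all_iff.2 fun k => ae_eventually_birkhoffSum_le hT hm.neg hg.neg (by
      simp only [Pi.neg_apply]
      rw [integral_neg]
      exact lt_add_of_pos_right _ Nat.one_div_pos_of_nat)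
  filter_upwards [hup, hlo] with x h1 h2
  refine tendsto_order.2 ⟨fun a ha => ?_, fun a ha => ?_⟩
  · obtain ⟨k, hk⟩ := exists_nat_one_div_lt (sub_pos.2 ha)
    filter_upwards [h2 k] with n hn
    have : birkhoffSum T (-g) n x = -birkhoffSum T g n x := by simp [birkhoffSum]
    rw [this, neg_div] at hn
    linarith
  · obtain ⟨k, hk⟩ := exists_nat_one_div_lt (sub_pos.2 ha)
    filter_upwards [h1 k] with n hn
    linarith

end Birkhoff

/-! ### From decay of correlations to invariant sets. -/

section Mixing

/-- A vector whose autocorrelations along the orbit of a contraction `U` tend to zero is orthogonal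
to every vector with constant correlation along that orbit. -/
theorem inner_eq_zero_of_tendsto_inner_iterate {E : Type*} [NormedAddCommGroup E]
    [InnerProductSpace ℂ E] [CompleteSpace E] (U : E →L[ℂ] E) (hU : ‖U‖ ≤ 1) {u v : E}
    (hu : Tendsto (fun n : ℕ => inner ℂ u (U^[n] u)) atTop (𝓝 0))
    (hv : ∀ n : ℕ, inner ℂ v (U^[n] u) = inner ℂ v u) : inner ℂ v u = 0 := by
  set K := U.eqLocus (1 : E →L[ℂ] E)
  have hlim := U.tendsto_birkhoffAverage_orthogonalProjection hU u
  set w : K := K.orthogonalProjectionOnto u with hw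
  have havg : ∀ (z : E) (n : ℕ), inner ℂ z (birkhoffAverage ℂ U _root_.id n u) =
      (n : ℝ)⁻¹ • ∑ k ∈ Finset.range n, inner ℂ z (U^[k] u) := fun z n => by
    simp [birkhoffAverage, birkhoffSum]
  -- The Birkhoff averages of `u` converge to its projection `w` on the fixed space, while their
  -- inner products with `u` are Cesàro means of a null sequence. Since `u - w` is orthogonal to
  -- `w`, this forces `w = 0`.
  have h1 : inner ℂ u (w : E) = 0 := by
    refine tendsto_nhds_unique (tendsto_const_nhds.inner hlim) ?_
    simp_rw [havg]
    exact hu.cesaro_smul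
  have hw0 : (w : E) = 0 := by
    have h2 : inner ℂ (u - (w : E)) (w : E) = 0 :=
      K.starProjection_inner_eq_zero u w w.2
    rw [inner_sub_left, h1, zero_sub, neg_eq_zero] at h2
    exact inner_self_eq_zero.1 h2
  have h3 : Tendsto (fun n : ℕ => inner ℂ v (birkhoffAverage ℂ U _root_.id n u)) atTop
      (𝓝 (inner ℂ v (w : E))) := tendsto_const_nhds.inner hlim
  rw [hw0, inner_zero_right] at h3
  refine tendsto_nhds_unique (tendsto_const_nhds.congr' ?_) h3
  filter_upwards [eventually_gt_atTop 0] with n hn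
  rw [havg]
  have : (n : ℂ) ≠ 0 := by exact_mod_cast hn.ne'
  simp [hv, this]

/-- Decay of correlations of `g` makes the integral of `g` over invariant sets vanish. -/
theorem setIntegral_eq_zero_of_tendsto_correlation {X : Type*} [MeasurableSpace X] {ν : Measure X}
    [IsProbabilityMeasure ν] {T : X → X} (hT : MeasurePreserving T ν ν) {g : X → ℂ}
    (hg : MemLp g 2 ν)
    (hcor : Tendsto (fun n : ℕ => ∫ x, g (T^[n] x) * (starRingEnd ℂ) (g x) ∂ν) atTop (𝓝 0))
    {A : Set X} (hA : MeasurableSet A) (hAT : T ⁻¹' A = A) : ∫ x in A, g x ∂ν = 0 := by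
  set U : Lp ℂ 2 ν →L[ℂ] Lp ℂ 2 ν :=
    (Lp.compMeasurePreservingₗᵢ ℂ T hT).toContinuousLinearMap with hU
  have hUn : ∀ n : ℕ, U^[n] (hg.toLp g) =
      (hg.comp_measurePreserving (hT.iterate n)).toLp (g ∘ T^[n]) := fun n => by
    induction n with
    | zero => rfl
    | succ n ih =>
      rw [Function.iterate_succ_apply', ih]
      have : g ∘ T^[n + 1] = (g ∘ T^[n]) ∘ T := by
        rw [Function.iterate_succ]; rfl
      simp only [this]
      rfl
  -- The test vector is the indicator of `A`: invariance of `A` makes its correlations with the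
  -- orbit of `g` constant.
  have key := inner_eq_zero_of_tendsto_inner_iterate U
    (LinearIsometry.norm_toContinuousLinearMap_le _) (u := hg.toLp g)
    (v := indicatorConstLp 2 hA (measure_ne_top ν A) (1 : ℂ)) ?_ ?_
  · rw [L2.inner_indicatorConstLp_one] at key
    rw [← key]
    exact integral_congr_ae (ae_restrict_of_ae hg.coeFn_toLp.symm)
  · refine hcor.congr fun n => ?_
    rw [hUn, L2.inner_def]
    refine integral_congr_ae ?_
    filter_upwards [hg.coeFn_toLp,
      (hg.comp_measurePreserving (hT.iterate n)).coeFn_toLp] with x h1 h2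
    rw [h1, h2]
    simp
  · intro n
    rw [hUn, L2.inner_indicatorConstLp_one, L2.inner_indicatorConstLp_one,
      integral_congr_ae (ae_restrict_of_ae hg.coeFn_toLp), integral_congr_ae
      (ae_restrict_of_ae (hg.comp_measurePreserving (hT.iterate n)).coeFn_toLp)]
    have hAn : T^[n] ⁻¹' A = A := by
      induction n with
      | zero => rfl
      | succ n ih => rw [Function.iterate_succ, preimage_comp, ih, hAT]
    have h := setIntegral_map (μ := ν) (f := g) (g := T^[n]) hA
      (by rw [(hT.iterate n).map_eq]; exact hg.aestronglyMeasurable)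
      (hT.iterate n).measurable.aemeasurable
    rw [(hT.iterate n).map_eq, hAn] at h
    exact h.symm

end Mixing

/-! ### Linear functionals of the path determine measures. -/

section Coordinates

variable {V : Type*} [NormedAddCommGroup V] [InnerProductSpace ℝ V]

/-- The real random variables that are finite linear combinations of `⟪x, ω t⟫`. -/
def linearFunctionals (V : Type*) [NormedAddCommGroup V] [InnerProductSpace ℝ V] :
    Submodule ℝ (PathSpace V → ℝ) :=
  Submodule.span ℝ (range fun (p : ℝ × V) (ω : PathSpace V) => inner ℝ p.2 (ω p.1))

theorem coordinate_mem (t : ℝ) (x : V) :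
    (fun ω : PathSpace V => inner ℝ x (ω t)) ∈ linearFunctionals V :=
  Submodule.subset_span ⟨(t, x), rfl⟩

theorem linearFunctionals_induction {p : (PathSpace V → ℝ) → Prop}
    (coord : ∀ t x, p fun ω => inner ℝ x (ω t)) (zero : p 0)
    (add : ∀ f ∈ linearFunctionals V, ∀ g ∈ linearFunctionals V, p f → p g → p (f + g))
    (smul : ∀ (c : ℝ), ∀ f ∈ linearFunctionals V, p f → p (c • f))
    {f : PathSpace V → ℝ} (hf : f ∈ linearFunctionals V) : p f := by
  refine Submodule.span_induction (p := fun f _ => p f) ?_ zero (fun f g hf hg => add f hf g hg)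
    (fun c f hf => smul c f hf) hf
  rintro _ ⟨q, rfl⟩
  exact coord q.1 q.2

theorem continuous_of_mem_linearFunctionals {f : PathSpace V → ℝ} (hf : f ∈ linearFunctionals V) :
    Continuous f :=
  linearFunctionals_induction (p := Continuous)
    (fun t _ => continuous_const.inner (continuous_apply_path t)) continuous_const
    (fun _ _ _ _ h h' => h.add h') (fun c _ _ h => h.const_smul c) hf

theorem comp_shift_mem {f : PathSpace V → ℝ} (hf : f ∈ linearFunctionals V) (s : ℝ) :
    (fun ω => f (shift s ω)) ∈ linearFunctionals V := by
  refine linearFunctionals_induction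
    (p := fun f => (fun ω => f (shift s ω)) ∈ linearFunctionals V)
    (fun t x => ?_) (Submodule.zero_mem _) (fun f _ g _ h h' => Submodule.add_mem _ h h')
    (fun c f _ h => Submodule.smul_mem _ c h) hf
  have := Submodule.sub_mem _ (coordinate_mem (s + t) x) (coordinate_mem s x)
  convert this using 1
  ext ω
  simp [inner_sub_right]

/-- A finite measure on path space is determined by the characteristic functions of the
finite linear combinations of coordinates. -/
theorem measure_ext_of_linearFunctionals [CompleteSpace V] [TopologicalSpace.SeparableSpace V]
    {ν₁ ν₂ : Measure (PathSpace V)} [IsFiniteMeasure ν₁] [IsFiniteMeasure ν₂]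
    (h : ∀ f ∈ linearFunctionals V,
      ∫ ω, Complex.exp (f ω * Complex.I) ∂ν₁ = ∫ ω, Complex.exp (f ω * Complex.I) ∂ν₂) :
    ν₁ = ν₂ := by
  -- Rational times and a dense sequence of vectors give countably many coordinates that still
  -- separate paths, by continuity in both variables.
  set Y : ℚ × ℕ → PathSpace V → ℝ :=
    fun p ω => inner ℝ (TopologicalSpace.denseSeq V p.2) (ω (p.1 : ℝ)) with hY
  set Φ : PathSpace V → (ℚ × ℕ → ℝ) := fun ω p => Y p ω with hΦ
  have hYm : ∀ p, Measurable (Y p) := fun p =>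
    (continuous_of_mem_linearFunctionals (coordinate_mem _ _)).measurable
  have hΦm : Measurable Φ := measurable_pi_lambda _ hYm
  have hinj : Function.Injective Φ := by
    intro ω ω' he
    have h1 : ∀ (q : ℚ), ω (q : ℝ) = ω' (q : ℝ) := fun q => by
      have h2 : ∀ x : V, inner ℝ x (ω (q : ℝ)) = inner ℝ x (ω' (q : ℝ)) := fun x => by
        have := (TopologicalSpace.denseRange_denseSeq V).equalizer
          (g := fun x => inner ℝ x (ω (q : ℝ))) (h := fun x => inner ℝ x (ω' (q : ℝ)))
          (by fun_prop) (by fun_prop) (funext fun n => congrFun he (q, n))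
        exact congrFun this x
      exact ext_inner_left ℝ h2
    have h3 := Rat.isDenseEmbedding_coe_real.dense.equalizer (continuous_path ω)
      (continuous_path ω') (funext h1)
    exact path_ext (congrFun h3)
  have hemb : MeasurableEmbedding Φ := hΦm.measurableEmbedding hinj
  have hfin : ∀ I : Finset (ℚ × ℕ),
      ν₁.map (fun ω => I.restrict (Y · ω)) = ν₂.map (fun ω => I.restrict (Y · ω)) := fun I => by
    have hm : Measurable fun ω => I.restrict (Y · ω) := by fun_prop
    refine Measure.ext_of_charFunDual (funext fun L => ?_)
    rw [charFunDual_apply, charFunDual_apply,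
      integral_map hm.aemeasurable (by fun_prop), integral_map hm.aemeasurable (by fun_prop)]
    refine h (fun ω => L (I.restrict (Y · ω))) ?_
    have hL : (fun ω => L (I.restrict (Y · ω))) =
        ∑ i : I, (L (Pi.single i 1)) • (Y i : PathSpace V → ℝ) := by
      ext ω
      have := L.toLinearMap.pi_apply_eq_sum_univ (I.restrict (Y · ω))
      simp only [ContinuousLinearMap.coe_coe] at this
      rw [this, Finset.sum_apply]
      refine Finset.sum_congr rfl fun i _ => ?_
      simp only [smul_eq_mul, Pi.smul_apply, Finset.restrict]
      rw [mul_comm]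
      congr 2
      ext j
      simp [Pi.single_apply, eq_comm]
    rw [hL]
    exact Submodule.sum_mem _ fun i _ => Submodule.smul_mem _ _ (coordinate_mem _ _)
  -- Both image laws are projective limits of the same finite-dimensional family, and such a limit
  -- is unique.
  have hmap : ν₁.map Φ = ν₂.map Φ := by
    have h1 := isProjectiveLimit_map (X := Y) (P := ν₁) hΦm.aemeasurable
    have h2 := isProjectiveLimit_map (X := Y) (P := ν₂) hΦm.aemeasurable
    simp_rw [hfin] at h1
    exact h1.unique h2
  rw [← hemb.comap_map ν₁, ← hemb.comap_map ν₂, hmap]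

end Coordinates

/-! ### Second differences of powers at infinity. -/

section Decay

/-- The mean value inequality on a half-line where the derivative is small. -/
theorem tendsto_sub_of_tendsto_deriv {φ φ' : ℝ → ℝ} {M : ℝ}
    (hd : ∀ x, M < x → HasDerivAt φ (φ' x) x) (h0 : Tendsto φ' atTop (𝓝 0)) (t : ℝ) :
    Tendsto (fun h => φ (h + t) - φ h) atTop (𝓝 0) := by
  rw [Metric.tendsto_atTop]
  intro ε hε
  obtain ⟨N, hN⟩ := (Metric.tendsto_atTop.1 h0) (ε / (|t| + 1)) (by positivity)
  refine ⟨max N M + 1 + |t|, fun h hh => ?_⟩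
  have hmem : ∀ x ∈ Ici (max N M + 1), HasDerivWithinAt φ (φ' x) (Ici (max N M + 1)) x ∧
      ‖φ' x‖ ≤ ε / (|t| + 1) := fun x hx => by
    have hx' : max N M + 1 ≤ x := hx
    refine ⟨(hd x (by linarith [le_max_right N M])).hasDerivWithinAt, ?_⟩
    have := hN x (by linarith [le_max_left N M])
    rw [dist_zero_right] at this
    exact this.le
  have := (convex_Ici (max N M + 1)).norm_image_sub_le_of_norm_hasDerivWithin_le
    (fun x hx => (hmem x hx).1) (fun x hx => (hmem x hx).2)
    (x := h) (y := h + t) (by simp only [mem_Ici]; linarith [abs_nonneg t])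
    (by simp only [mem_Ici]; linarith [neg_abs_le t])
  rw [dist_zero_right]
  refine this.trans_lt ?_
  rw [add_sub_cancel_left, Real.norm_eq_abs, div_mul_eq_mul_div, div_lt_iff₀ (by positivity)]
  nlinarith

/-- The mixed second differences of `|h| ^ r` tend to zero at infinity when `r < 2`. -/
theorem tendsto_second_difference {r : ℝ} (h2 : r < 2) (s t : ℝ) :
    Tendsto (fun h : ℝ => |h + t| ^ r - |h + t - s| ^ r - |h| ^ r + |h - s| ^ r) atTop (𝓝 0) := by
  have hd1 : ∀ x : ℝ, 0 < x → HasDerivAt (fun x => x ^ r) (r * x ^ (r - 1)) x := fun x hx =>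
    Real.hasDerivAt_rpow_const (Or.inl hx.ne')
  have hd2 : ∀ x : ℝ, 0 < x →
      HasDerivAt (fun x => r * x ^ (r - 1)) (r * ((r - 1) * x ^ (r - 1 - 1))) x := fun x hx =>
    (Real.hasDerivAt_rpow_const (Or.inl hx.ne')).const_mul r
  have hlim2 : Tendsto (fun x : ℝ => r * ((r - 1) * x ^ (r - 1 - 1))) atTop (𝓝 0) := by
    have h := tendsto_rpow_neg_atTop (show (0 : ℝ) < 2 - r by linarith)
    have h' := (h.const_mul (r - 1)).const_mul r
    simp only [mul_zero] at h'
    refine h'.congr fun x => ?_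
    congr 3
    ring
  -- The second derivative of `x ^ r` has exponent `r - 2 < 0`, so increments of the first
  -- derivative vanish at infinity; a second use of the same lemma handles the mixed difference.
  have hlim1 := tendsto_sub_of_tendsto_deriv hd2 hlim2 (-s)
  have hd3 : ∀ x : ℝ, |s| < x → HasDerivAt (fun x => (x + -s) ^ r - x ^ r)
      (r * (x + -s) ^ (r - 1) - r * x ^ (r - 1)) x := fun x hx => by
    have hx0 : 0 < x := (abs_nonneg s).trans_lt hx
    have hxs : 0 < x + -s := by linarith [le_abs_self s]
    exact ((hd1 _ hxs).comp_add_const x (-s)).sub (hd1 x hx0)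
  have hlim := (tendsto_sub_of_tendsto_deriv hd3 hlim1 t).neg
  rw [neg_zero] at hlim
  refine hlim.congr' ?_
  filter_upwards [eventually_gt_atTop (|s| + |t|)] with h hh
  have := neg_abs_le t
  have := le_abs_self s
  have := abs_nonneg t
  have := abs_nonneg s
  rw [abs_of_pos (show 0 < h + t by linarith), abs_of_pos (show 0 < h + t - s by linarith),
    abs_of_pos (show 0 < h by linarith), abs_of_pos (show 0 < h - s by linarith)]
  simp only [← sub_eq_add_neg]
  ring

end Decay

/-! ### Iterates of the unit shifts. -/

section ShiftIterates

variable {V : Type*} [NormedAddCommGroup V]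

theorem iterate_shift_one (n : ℕ) (ω : PathSpace V) : (shift 1)^[n] ω = shift n ω := by
  induction n with
  | zero => simp
  | succ n ih =>
    rw [Function.iterate_succ_apply', ih, shift_shift]
    push_cast
    rfl

theorem iterate_shift_neg_one (n : ℕ) (ω : PathSpace V) : (shift (-1))^[n] ω = shift (-n) ω := by
  induction n with
  | zero => simp
  | succ n ih =>
    rw [Function.iterate_succ_apply', ih, shift_shift]
    push_cast
    congr 1
    ring

end ShiftIterates

/-! ### Invariance and ergodicity of the fractional Brownian law. -/

section Gaussian

variable {V : Type*} [NormedAddCommGroup V] [InnerProductSpace ℝ V] {H : ℝ} {Q : V →L[ℝ] V}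
  {P : Measure (PathSpace V)} {f g : PathSpace V → ℝ}

theorem IsFBMLaw.hasGaussianLaw (hP : IsFBMLaw H Q P) (hf : f ∈ linearFunctionals V) :
    HasGaussianLaw f P := by
  obtain ⟨c, rfl⟩ := (Finsupp.mem_span_range_iff_exists_finsupp).1 hf
  have h := (hP.gaussian.smul c).hasGaussianLaw_sum (I := c.support)
  exact h

theorem IsFBMLaw.memLp (hP : IsFBMLaw H Q P) (hf : f ∈ linearFunctionals V) : MemLp f 2 P :=
  (hP.hasGaussianLaw hf).memLp_two

theorem IsFBMLaw.integral_eq_zero (hP : IsFBMLaw H Q P) (hf : f ∈ linearFunctionals V) :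
    ∫ ω, f ω ∂P = 0 := by
  refine linearFunctionals_induction (p := fun f => ∫ ω, f ω ∂P = 0)
    (fun t x => hP.centered t x) (by simp) (fun f hf g hg h h' => ?_) (fun c f _ h => ?_) hf
  · simp only [Pi.add_apply]
    rw [integral_add (hP.hasGaussianLaw hf).integrable (hP.hasGaussianLaw hg).integrable, h, h',
      add_zero]
  · simp only [Pi.smul_apply]
    rw [integral_smul, h, smul_zero]

/-- A centered Gaussian variable is determined by its variance; every later comparison of laws
thereby reduces to covariances. -/
theorem IsFBMLaw.integral_exp (hP : IsFBMLaw H Q P) (hf : f ∈ linearFunctionals V) :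
    ∫ ω, Complex.exp (f ω * Complex.I) ∂P = Real.exp (-(Var[f; P] / 2)) := by
  have h := (hP.hasGaussianLaw hf).charFun_map_eq 1
  have hm := (continuous_of_mem_linearFunctionals hf).measurable
  rw [charFun_apply, integral_map hm.aemeasurable (by fun_prop)] at h
  simp only [RCLike.inner_apply, conj_trivial, mul_one, one_mul, hP.integral_eq_zero hf] at h
  rw [h]
  push_cast
  congr 1
  ring

/-- Covariances of linear functionals are invariant under the shift flow. -/
theorem IsFBMLaw.covariance_shift_shift [IsProbabilityMeasure P] (hP : IsFBMLaw H Q P) (hH : 0 < H)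
    (s : ℝ) (hf : f ∈ linearFunctionals V) (hg : g ∈ linearFunctionals V) :
    cov[fun ω => f (shift s ω), fun ω => g (shift s ω); P] = cov[f, g; P] := by
  refine linearFunctionals_induction
    (p := fun f => cov[fun ω => f (shift s ω), fun ω => g (shift s ω); P] = cov[f, g; P])
    (fun a x => ?_) ?_ (fun f hf f' hf' h h' => ?_) (fun c f _ h => ?_) hf
  · refine linearFunctionals_induction
      (p := fun g => cov[fun ω => inner ℝ x (shift s ω a), fun ω => g (shift s ω); P] =
        cov[fun ω : PathSpace V => inner ℝ x (ω a), g; P])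
      (fun b y => ?_) ?_ (fun f hf f' hf' h h' => ?_) (fun c f _ h => ?_) hg
    · simp only [shift_apply, inner_sub_right]
      have hc := fun t z => hP.memLp (coordinate_mem (V := V) t z)
      rw [covariance_fun_sub_fun_sub (hc _ _) (hc _ _) (hc _ _) (hc _ _), hP.covariance_eq,
        hP.covariance_eq, hP.covariance_eq, hP.covariance_eq, hP.covariance_eq]
      -- Positivity of `H` enters here, since `0 ^ 0 = 1`.
      have h0 : |(0 : ℝ)| ^ (2 * H) = 0 := by
        rw [abs_zero, Real.zero_rpow (by positivity)]
      have e1 : s + b - (s + a) = b - a := by ring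
      have e2 : s - (s + a) = -a := by ring
      have e3 : s + b - s = b := by ring
      rw [e1, e2, e3, sub_self, h0, abs_neg]
      ring
    · simp only [Pi.zero_apply]
      rw [covariance_const_right, covariance_zero_right]
    · have e : (fun ω => (f + f') (shift s ω)) =
        (fun ω => f (shift s ω)) + fun ω => f' (shift s ω) := rfl
      rw [e, covariance_add_right (hP.memLp (comp_shift_mem (coordinate_mem a x) s))
        (hP.memLp (comp_shift_mem hf s)) (hP.memLp (comp_shift_mem hf' s)), h, h',
        covariance_add_right (hP.memLp (coordinate_mem a x)) (hP.memLp hf) (hP.memLp hf')]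
    · have e : (fun ω => (c • f) (shift s ω)) = c • fun ω => f (shift s ω) := rfl
      rw [e, covariance_smul_right, covariance_smul_right, h]
  · simp only [Pi.zero_apply]
    rw [covariance_const_left, covariance_zero_left]
  · have e : (fun ω => (f + f') (shift s ω)) =
      (fun ω => f (shift s ω)) + fun ω => f' (shift s ω) := rfl
    rw [e, covariance_add_left (hP.memLp (comp_shift_mem hf s))
      (hP.memLp (comp_shift_mem hf' s)) (hP.memLp (comp_shift_mem hg s)), h, h',
      covariance_add_left (hP.memLp hf) (hP.memLp hf') (hP.memLp hg)]
  · have e : (fun ω => (c • f) (shift s ω)) = c • fun ω => f (shift s ω) := rfl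
    rw [e, covariance_smul_left, covariance_smul_left, h]

/-- On coordinates the covariance is a multiple of a mixed second difference of `|h| ^ (2 * H)`, and
`2 * H < 2`; bilinearity does the rest. -/
theorem IsFBMLaw.tendsto_covariance_shift [IsProbabilityMeasure P] (hP : IsFBMLaw H Q P)
    (hH : H < 1) (hf : f ∈ linearFunctionals V) (hg : g ∈ linearFunctionals V) :
    Tendsto (fun h : ℝ => cov[f, fun ω => g (shift h ω); P]) atTop (𝓝 0) := by
  refine linearFunctionals_induction
    (p := fun f => Tendsto (fun h : ℝ => cov[f, fun ω => g (shift h ω); P]) atTop (𝓝 0))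
    (fun s x => ?_) ?_ (fun f hf f' hf' h h' => ?_) (fun c f _ h => ?_) hf
  · refine linearFunctionals_induction
      (p := fun g => Tendsto (fun h : ℝ => cov[fun ω : PathSpace V => inner ℝ x (ω s),
        fun ω => g (shift h ω); P]) atTop (𝓝 0))
      (fun t y => ?_) ?_ (fun f hf f' hf' h h' => ?_) (fun c f _ h => ?_) hg
    · simp only [shift_apply, inner_sub_right]
      have hc := fun t z => hP.memLp (coordinate_mem (V := V) t z)
      have hlim := (tendsto_second_difference (show 2 * H < 2 by linarith) s t).const_mul
        (1 / 2 * inner ℝ (Q x) y)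
      rw [mul_zero] at hlim
      refine hlim.congr fun h => ?_
      rw [covariance_fun_sub_right (hc _ _) (hc _ _) (hc _ _), hP.covariance_eq, hP.covariance_eq]
      ring
    · simp only [Pi.zero_apply, covariance_const_right]
      exact tendsto_const_nhds
    · have hlim := h.add h'
      rw [add_zero] at hlim
      refine hlim.congr fun u => ?_
      exact (covariance_add_right (hP.memLp (coordinate_mem s x))
        (hP.memLp (comp_shift_mem hf u)) (hP.memLp (comp_shift_mem hf' u))).symm
    · have hlim := h.const_mul c
      rw [mul_zero] at hlim
      exact hlim.congr fun u => (covariance_smul_right c).symm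
  · simp only [covariance_zero_left]
    exact tendsto_const_nhds
  · have hlim := h.add h'
    rw [add_zero] at hlim
    refine hlim.congr fun u => ?_
    exact (covariance_add_left (hP.memLp hf) (hP.memLp hf') (hP.memLp (comp_shift_mem hg u))).symm
  · have hlim := h.const_mul c
    rw [mul_zero] at hlim
    exact hlim.congr fun u => (covariance_smul_left c).symm

theorem IsFBMLaw.variance_shift [IsProbabilityMeasure P] (hP : IsFBMLaw H Q P) (hH : 0 < H)
    (s : ℝ) (hf : f ∈ linearFunctionals V) : Var[fun ω => f (shift s ω); P] = Var[f; P] := by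
  rw [← covariance_self (hP.memLp (comp_shift_mem hf s)).aemeasurable,
    ← covariance_self (hP.memLp hf).aemeasurable, hP.covariance_shift_shift hH s hf hf]

/-- With `v` the variance of `f` and `c` its covariance with its `n`-fold shift, the Gaussian
formula gives the integral as `exp (-(v - c)) - exp (-v)`, and `c → 0`. -/
theorem IsFBMLaw.tendsto_correlation [IsProbabilityMeasure P] (hP : IsFBMLaw H Q P)
    (hH0 : 0 < H) (hH : H < 1) (hf : f ∈ linearFunctionals V) :
    Tendsto (fun n : ℕ => ∫ ω, (Complex.exp (f ((shift 1)^[n] ω) * Complex.I) -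
        Real.exp (-(Var[f; P] / 2))) *
      (starRingEnd ℂ) (Complex.exp (f ω * Complex.I) - Real.exp (-(Var[f; P] / 2))) ∂P)
      atTop (𝓝 0) := by
  set v := Var[f; P] with hv
  have hm := (continuous_of_mem_linearFunctionals hf).measurable
  have hbd : ∀ {h : PathSpace V → ℝ}, Measurable h →
      Integrable (fun ω => Complex.exp (h ω * Complex.I)) P := fun hh =>
    Integrable.of_bound (by fun_prop) 1 (.of_forall fun ω => by
      rw [Complex.norm_exp_ofReal_mul_I])
  have hval : ∀ n : ℕ, ∫ ω, (Complex.exp (f ((shift 1)^[n] ω) * Complex.I) -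
        Real.exp (-(v / 2))) *
      (starRingEnd ℂ) (Complex.exp (f ω * Complex.I) - Real.exp (-(v / 2))) ∂P =
      ((Real.exp (-(v - cov[f, fun ω => f (shift (n : ℝ) ω); P])) - Real.exp (-v) : ℝ) : ℂ) := by
    intro n
    have hfn := comp_shift_mem hf (n : ℝ)
    have hmn := (continuous_of_mem_linearFunctionals hfn).measurable
    have e : ∀ ω, (Complex.exp (f ((shift 1)^[n] ω) * Complex.I) - Real.exp (-(v / 2))) *
      (starRingEnd ℂ) (Complex.exp (f ω * Complex.I) - Real.exp (-(v / 2))) =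
      Complex.exp (((f (shift (n : ℝ) ω) - f ω : ℝ) : ℂ) * Complex.I)
      - Real.exp (-(v / 2)) * Complex.exp (f (shift (n : ℝ) ω) * Complex.I)
      - Real.exp (-(v / 2)) * Complex.exp (((-f ω : ℝ) : ℂ) * Complex.I)
      + Real.exp (-v) := fun ω => by
      have e1 : (Real.exp (-v) : ℂ) = Real.exp (-(v / 2)) * Real.exp (-(v / 2)) := by
        rw [← Complex.ofReal_mul, ← Real.exp_add]
        congr 2
        ring
      have e2 : Complex.exp (((f (shift (n : ℝ) ω) - f ω : ℝ) : ℂ) * Complex.I) =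
          Complex.exp (f (shift (n : ℝ) ω) * Complex.I) *
            Complex.exp (((-f ω : ℝ) : ℂ) * Complex.I) := by
        rw [← Complex.exp_add]
        congr 1
        push_cast
        ring
      rw [iterate_shift_one, map_sub, ← Complex.exp_conj, map_mul, Complex.conj_I,
        Complex.conj_ofReal, Complex.conj_ofReal, e1, e2, mul_neg, ← neg_mul, Complex.ofReal_neg]
      ring
    simp_rw [e]
    have i1 : Integrable (fun ω => Complex.exp (((f (shift (n : ℝ) ω) - f ω : ℝ) : ℂ) *
      Complex.I)) P := hbd (hmn.sub hm)
    have i2 := (hbd hmn).const_mul (Real.exp (-(v / 2)) : ℂ)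
    have i3 : Integrable (fun ω => (Real.exp (-(v / 2)) : ℂ) *
      Complex.exp (((-f ω : ℝ) : ℂ) * Complex.I)) P := (hbd hm.neg).const_mul _
    have i12 : Integrable (fun ω => Complex.exp (((f (shift (n : ℝ) ω) - f ω : ℝ) : ℂ) *
      Complex.I) - Real.exp (-(v / 2)) * Complex.exp (f (shift (n : ℝ) ω) * Complex.I)) P :=
      i1.sub i2
    have i123 : Integrable (fun ω => Complex.exp (((f (shift (n : ℝ) ω) - f ω : ℝ) : ℂ) *
      Complex.I) - Real.exp (-(v / 2)) * Complex.exp (f (shift (n : ℝ) ω) * Complex.I) -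
      Real.exp (-(v / 2)) * Complex.exp (((-f ω : ℝ) : ℂ) * Complex.I)) P := i12.sub i3
    rw [integral_add i123 (integrable_const _), integral_sub i12 i3,
      integral_sub i1 i2, integral_const_mul, integral_const_mul, hP.integral_exp hfn,
      hP.integral_exp (f := fun ω => f (shift (n : ℝ) ω) - f ω) (Submodule.sub_mem _ hfn hf),
      hP.integral_exp (f := fun ω => -f ω) (Submodule.neg_mem _ hf), hP.variance_shift hH0 _ hf]
    have hvar : Var[fun ω => f (shift (n : ℝ) ω) - f ω; P] =
        2 * v - 2 * cov[f, fun ω => f (shift (n : ℝ) ω); P] := by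
      rw [variance_fun_sub (hP.memLp hfn) (hP.memLp hf), hP.variance_shift hH0 _ hf,
        covariance_comm]
      ring
    have hneg : Var[fun ω => -f ω; P] = v := by
      rw [variance_fun_neg]
    have e1 : Real.exp (-(v / 2)) * Real.exp (-(v / 2)) = Real.exp (-v) := by
      rw [← Real.exp_add]
      congr 1
      ring
    rw [hvar, hneg, integral_const, ← hv]
    simp only [probReal_univ, one_smul, ← Complex.ofReal_mul, ← Complex.ofReal_sub,
      ← Complex.ofReal_add, e1]
    congr 1
    have e2 : -((2 * v - 2 * cov[f, fun ω => f (shift (n : ℝ) ω); P]) / 2) =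
        -(v - cov[f, fun ω => f (shift (n : ℝ) ω); P]) := by ring
    rw [e2]
    ring
  simp_rw [hval]
  have hc := (hP.tendsto_covariance_shift hH hf hf).comp tendsto_natCast_atTop_atTop
  have h1 : Tendsto (fun n : ℕ =>
      Real.exp (-(v - cov[f, fun ω => f (shift (n : ℝ) ω); P])) - Real.exp (-v)) atTop (𝓝 0) := by
    have := ((Real.continuous_exp.tendsto _).comp ((tendsto_const_nhds (x := v)).sub hc).neg).sub
      (tendsto_const_nhds (x := Real.exp (-v)))
    simpa using this
  exact_mod_cast (Complex.continuous_ofReal.tendsto 0).comp h1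

variable [CompleteSpace V] [TopologicalSpace.SeparableSpace V]

/-- The law of fractional Brownian motion is invariant under the shift flow. -/
theorem IsFBMLaw.measurePreserving_shift [IsProbabilityMeasure P] (hP : IsFBMLaw H Q P)
    (hH : 0 < H) (s : ℝ) : MeasurePreserving (shift s) P P := by
  refine ⟨measurable_shift s, ?_⟩
  have : IsProbabilityMeasure (P.map (shift s)) :=
    Measure.isProbabilityMeasure_map (measurable_shift s).aemeasurable
  refine measure_ext_of_linearFunctionals fun f hf => ?_
  have hm := (continuous_of_mem_linearFunctionals hf).measurable
  rw [integral_map (measurable_shift s).aemeasurable (by fun_prop),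
    hP.integral_exp (comp_shift_mem hf s), hP.integral_exp hf, hP.variance_shift hH s hf]

/-- The unit shift is ergodic for the law of fractional Brownian motion. -/
theorem IsFBMLaw.ergodic_shift_one [IsProbabilityMeasure P] (hP : IsFBMLaw H Q P)
    (hH0 : 0 < H) (hH : H < 1) : Ergodic (shift 1) P := by
  refine ⟨hP.measurePreserving_shift hH0 1, ⟨fun A hA hAT => ?_⟩⟩
  -- The centered exponentials integrate to zero over the invariant set `A`, so both measures have
  -- the same characteristic functions. Evaluation at `A` then gives `P A = P A * P A`.
  have hmeas : P.restrict A = P A • P := by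
    have : IsFiniteMeasure (P A • P) := P.smul_finite (measure_ne_top P A)
    refine measure_ext_of_linearFunctionals fun f hf => ?_
    have hm := (continuous_of_mem_linearFunctionals hf).measurable
    have hi : Integrable (fun ω => Complex.exp (f ω * Complex.I)) P :=
      Integrable.of_bound (by fun_prop) 1 (.of_forall fun ω => by
        rw [Complex.norm_exp_ofReal_mul_I])
    have hg : MemLp (fun ω => Complex.exp (f ω * Complex.I) - Real.exp (-(Var[f; P] / 2))) 2 P := by
      refine MemLp.sub (MemLp.of_bound (by fun_prop) 1 (.of_forall fun ω => ?_)) (memLp_const _)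
      rw [Complex.norm_exp_ofReal_mul_I]
    have h := setIntegral_eq_zero_of_tendsto_correlation (hP.measurePreserving_shift hH0 1) hg
      (hP.tendsto_correlation hH0 hH hf) hA hAT
    rw [integral_sub hi.integrableOn (integrable_const _), sub_eq_zero] at h
    rw [h, integral_smul_measure, hP.integral_exp hf]
    simp [Measure.real]
  have h1 := congrArg (fun ν => ν A) hmeas
  simp only [Measure.restrict_apply_self, Measure.smul_apply, smul_eq_mul] at h1
  rw [eventuallyConst_set']
  rcases eq_or_ne (P A) 0 with h0 | h0
  · exact Or.inl (ae_eq_empty.2 h0)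
  · right
    rw [ae_eq_univ, prob_compl_eq_zero_iff hA]
    exact (ENNReal.mul_right_inj h0 (measure_ne_top P A)).1 (by rw [← h1, mul_one])

theorem IsFBMLaw.ergodic_shift_neg_one [IsProbabilityMeasure P] (hP : IsFBMLaw H Q P)
    (hH0 : 0 < H) (hH : H < 1) : Ergodic (shift (-1)) P := by
  refine ⟨hP.measurePreserving_shift hH0 (-1), ⟨fun A hA hAT => ?_⟩⟩
  refine (hP.ergodic_shift_one hH0 hH).toPreErgodic.aeconst_set hA ?_
  conv_lhs => rw [← hAT, ← preimage_comp]
  have : (shift (-1) ∘ shift 1 : PathSpace V → PathSpace V) = id := by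
    ext1 ω
    simp [shift_shift]
  rw [this, preimage_id]

end Gaussian

/-! ### Dyadic chaining on the unit interval. -/

section Chaining

/-- The dyadic approximation of order `m` from below. -/
noncomputable def dyadicFloor (m : ℕ) (t : ℝ) : ℝ := (⌊2 ^ m * t⌋₊ : ℝ) / 2 ^ m

theorem dyadicFloor_le {m : ℕ} {t : ℝ} (ht : 0 ≤ t) : dyadicFloor m t ≤ t := by
  rw [dyadicFloor, div_le_iff₀ (by positivity), mul_comm]
  exact Nat.floor_le (by positivity)

theorem lt_dyadicFloor_add (m : ℕ) (t : ℝ) : t < dyadicFloor m t + (1 / 2) ^ m := by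
  rw [dyadicFloor, one_div_pow, ← add_div, lt_div_iff₀ (by positivity), mul_comm]
  exact Nat.lt_floor_add_one _

theorem tendsto_dyadicFloor {t : ℝ} (ht : 0 ≤ t) :
    Tendsto (fun m => dyadicFloor m t) atTop (𝓝 t) := by
  have h : Tendsto (fun m : ℕ => t - (1 / 2 : ℝ) ^ m) atTop (𝓝 t) := by
    simpa using tendsto_const_nhds.sub
      (tendsto_pow_atTop_nhds_zero_of_lt_one (r := (1 / 2 : ℝ)) (by norm_num) (by norm_num))
  exact tendsto_of_tendsto_of_tendsto_of_le_of_le h tendsto_const_nhds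
    (fun m => by linarith [lt_dyadicFloor_add m t]) (fun m => dyadicFloor_le ht)

variable {E : Type*} [NormedAddCommGroup E] {f : ℝ → E} {B r : ℝ}

/-- Points at distance at most `2⁻ᵐ` have equal or adjacent dyadic floors of order `m`. -/
theorem norm_dyadicFloor_sub_le (hB : 0 ≤ B) (hr : 0 ≤ r)
    (h : ∀ m k : ℕ, k < 2 ^ m → ‖f ((k + 1) / 2 ^ m) - f (k / 2 ^ m)‖ ≤ B * r ^ m)
    {m : ℕ} {s t : ℝ} (hs : 0 ≤ s) (hst : s ≤ t) (ht : t ≤ 1) (hd : t - s ≤ (1 / 2) ^ m) :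
    ‖f (dyadicFloor m t) - f (dyadicFloor m s)‖ ≤ B * r ^ m := by
  have hp : (0 : ℝ) < 2 ^ m := by positivity
  set j := ⌊2 ^ m * s⌋₊ with hj
  have h1 : j ≤ ⌊2 ^ m * t⌋₊ := Nat.floor_le_floor (by nlinarith)
  have h2 : ⌊2 ^ m * t⌋₊ < j + 2 := by
    rw [Nat.floor_lt (mul_nonneg hp.le (hs.trans hst))]
    have h3 := Nat.lt_floor_add_one (2 ^ m * s)
    have h4 : 2 ^ m * (t - s) ≤ 1 := by
      calc 2 ^ m * (t - s) ≤ 2 ^ m * (1 / 2) ^ m := by gcongr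
        _ = 1 := by rw [← mul_pow]; norm_num
    push_cast
    nlinarith
  rcases (show ⌊2 ^ m * t⌋₊ = j ∨ ⌊2 ^ m * t⌋₊ = j + 1 by omega) with h3 | h3
  · simp only [dyadicFloor, h3, ← hj, sub_self, norm_zero]
    positivity
  · have h4 : j + 1 ≤ 2 ^ m := by
      rw [← h3]
      refine Nat.floor_le_of_le ?_
      push_cast
      nlinarith
    have := h m j (by omega)
    simpa only [dyadicFloor, h3, ← hj, Nat.cast_add, Nat.cast_one] using this

/-- Refining the floor by one order either fixes it or moves it by one step of the finer grid. -/
theorem norm_dyadicFloor_succ_sub_le (hB : 0 ≤ B) (hr : 0 ≤ r)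
    (h : ∀ m k : ℕ, k < 2 ^ m → ‖f ((k + 1) / 2 ^ m) - f (k / 2 ^ m)‖ ≤ B * r ^ m)
    {m : ℕ} {t : ℝ} (ht0 : 0 ≤ t) (ht : t ≤ 1) :
    ‖f (dyadicFloor (m + 1) t) - f (dyadicFloor m t)‖ ≤ B * r ^ (m + 1) := by
  have hp : (0 : ℝ) < 2 ^ m := by positivity
  set j := ⌊2 ^ m * t⌋₊ with hj
  have hpow : (2 : ℝ) ^ (m + 1) * t = 2 * (2 ^ m * t) := by ring
  have hx : 0 ≤ 2 ^ m * t := by positivity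
  have h1 : 2 * j ≤ ⌊2 ^ (m + 1) * t⌋₊ := by
    refine Nat.le_floor ?_
    push_cast
    rw [hpow]
    linarith [Nat.floor_le hx]
  have h2 : ⌊2 ^ (m + 1) * t⌋₊ < 2 * j + 2 := by
    rw [Nat.floor_lt (by positivity), hpow]
    push_cast
    linarith [Nat.lt_floor_add_one (2 ^ m * t)]
  have hdj : dyadicFloor m t = ((2 * j : ℕ) : ℝ) / 2 ^ (m + 1) := by
    rw [dyadicFloor, ← hj, pow_succ]
    push_cast
    field_simp
  rcases (show ⌊2 ^ (m + 1) * t⌋₊ = 2 * j ∨ ⌊2 ^ (m + 1) * t⌋₊ = 2 * j + 1 by omega)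
    with h3 | h3
  · rw [hdj, dyadicFloor, h3, sub_self, norm_zero]
    positivity
  · have h4 : 2 * j + 1 ≤ 2 ^ (m + 1) := by
      rw [← h3]
      refine Nat.floor_le_of_le ?_
      push_cast
      have : (0 : ℝ) < 2 ^ (m + 1) := by positivity
      nlinarith
    have := h (m + 1) (2 * j) (by omega)
    rw [hdj, dyadicFloor, h3, Nat.cast_add, Nat.cast_one]
    exact this

theorem norm_sub_dyadicFloor_le (hf : Continuous f) (hB : 0 ≤ B) (hr : 0 ≤ r) (hr1 : r < 1)
    (h : ∀ m k : ℕ, k < 2 ^ m → ‖f ((k + 1) / 2 ^ m) - f (k / 2 ^ m)‖ ≤ B * r ^ m)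
    (n : ℕ) {t : ℝ} (ht0 : 0 ≤ t) (ht : t ≤ 1) :
    ‖f t - f (dyadicFloor n t)‖ ≤ B * r ^ n / (1 - r) := by
  have hlim : Tendsto (fun j => f (dyadicFloor (j + n) t)) atTop (𝓝 (f t)) :=
    (hf.tendsto t).comp ((tendsto_add_atTop_iff_nat n).2 (tendsto_dyadicFloor ht0))
  have := dist_le_of_le_geometric_of_tendsto₀ r (B * r ^ n) hr1 (fun j => ?_) hlim
  · rw [dist_comm, dist_eq_norm, zero_add] at this
    exact this
  · rw [dist_comm, dist_eq_norm, add_right_comm]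
    refine (norm_dyadicFloor_succ_sub_le hB hr h ht0 ht).trans ?_
    calc B * r ^ (j + n + 1) = B * r ^ n * r ^ j * r := by ring
      _ ≤ B * r ^ n * r ^ j := mul_le_of_le_one_right (by positivity) hr1.le

/-- The constant in the dyadic chaining bound. -/
noncomputable def chainingConst (γ : ℝ) : ℝ := (1 + 2 / (1 - (1 / 2 : ℝ) ^ γ)) * 2 ^ γ

theorem half_rpow_lt_one {γ : ℝ} (hγ : 0 < γ) : (1 / 2 : ℝ) ^ γ < 1 :=
  Real.rpow_lt_one (by norm_num) (by norm_num) hγ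

theorem chainingConst_pos {γ : ℝ} (hγ : 0 < γ) : 0 < chainingConst γ := by
  have := half_rpow_lt_one hγ
  have : 0 < 1 - (1 / 2 : ℝ) ^ γ := by linarith
  unfold chainingConst
  positivity

/-- **Dyadic chaining**: control of the dyadic increments yields Hölder continuity. -/
theorem norm_sub_le_of_dyadic {γ : ℝ} (hγ : 0 < γ) (hf : Continuous f) (hB : 0 ≤ B)
    (h : ∀ m k : ℕ, k < 2 ^ m →
      ‖f ((k + 1) / 2 ^ m) - f (k / 2 ^ m)‖ ≤ B * ((1 / 2 : ℝ) ^ γ) ^ m)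
    {s t : ℝ} (hs : 0 ≤ s) (hst : s < t) (ht : t ≤ 1) :
    ‖f t - f s‖ ≤ chainingConst γ * B * (t - s) ^ γ := by
  set r : ℝ := (1 / 2 : ℝ) ^ γ with hr
  have hr0 : 0 ≤ r := by positivity
  have hr1 : r < 1 := half_rpow_lt_one hγ
  -- The scale with `2⁻⁽ⁿ⁺¹⁾ < t - s ≤ 2⁻ⁿ`: the upper bound makes the floors neighbours, the lower
  -- one costs the factor `2 ^ γ`.
  obtain ⟨n, hn1, hn2⟩ := exists_nat_pow_near_of_lt_one (x := t - s) (y := (1 / 2 : ℝ))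
    (by linarith) (by linarith) (by norm_num) (by norm_num)
  have h1 := norm_sub_dyadicFloor_le hf hB hr0 hr1 h n (hs.trans hst.le) ht
  have h2 := norm_sub_dyadicFloor_le hf hB hr0 hr1 h n hs (hst.le.trans ht)
  have h3 := norm_dyadicFloor_sub_le hB hr0 h hs hst.le ht hn2
  have h4 : ‖f t - f s‖ ≤ ‖f t - f (dyadicFloor n t)‖ +
      ‖f (dyadicFloor n t) - f (dyadicFloor n s)‖ + ‖f s - f (dyadicFloor n s)‖ := by
    have e : f t - f s = (f t - f (dyadicFloor n t)) +
      (f (dyadicFloor n t) - f (dyadicFloor n s)) - (f s - f (dyadicFloor n s)) := by abel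
    rw [e]
    exact (norm_sub_le _ _).trans (add_le_add_left (norm_add_le _ _) _)
  have h5 : r ^ n ≤ 2 ^ γ * (t - s) ^ γ := by
    rw [hr, ← Real.rpow_natCast, ← Real.rpow_mul (by norm_num), mul_comm, Real.rpow_mul
      (by norm_num), Real.rpow_natCast, ← Real.mul_rpow (by norm_num) (by linarith)]
    refine Real.rpow_le_rpow (by positivity) ?_ hγ.le
    rw [pow_succ] at hn1
    linarith
  have h6 : 0 < 1 - r := by linarith
  calc ‖f t - f s‖ ≤ B * r ^ n / (1 - r) + B * r ^ n + B * r ^ n / (1 - r) := by linarith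
    _ = (1 + 2 / (1 - r)) * B * r ^ n := by ring
    _ ≤ (1 + 2 / (1 - r)) * B * (2 ^ γ * (t - s) ^ γ) := by gcongr
    _ = chainingConst γ * B * (t - s) ^ γ := by rw [chainingConst]; ring

end Chaining

/-! ### Moments of Hölder seminorms from moments of increments. -/

section SeminormBound

variable {V : Type*} [NormedAddCommGroup V]

/-- The sum of the `p`-th powers of all weighted dyadic increments on `[a, a + L]`. -/
noncomputable def dyadicEnergy (γ p a L : ℝ) (ω : PathSpace V) : ℝ≥0∞ :=
  ∑' m : ℕ, ∑ k ∈ Finset.range (2 ^ m), ENNReal.ofReal (2 ^ (γ * p * m)) *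
    ‖ω (a + L * ((k + 1) / 2 ^ m)) - ω (a + L * (k / 2 ^ m))‖ₑ ^ p

/-- Each weighted increment is at most the `p`-th root of the whole energy, so chaining applies to
`u ↦ ω (a + L * u)`; undoing the scaling produces `L ^ γ`. -/
theorem holderSeminorm_rpow_le {γ p a L : ℝ} (hγ : 0 < γ) (hp : 0 < p) (hL : 0 < L)
    (ω : PathSpace V) :
    holderSeminorm γ a (a + L) ω ^ p ≤
      ENNReal.ofReal (chainingConst γ / L ^ γ) ^ p * dyadicEnergy γ p a L ω := by
  have hc : 0 < chainingConst γ / L ^ γ := div_pos (chainingConst_pos hγ) (by positivity)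
  have hc0 : ENNReal.ofReal (chainingConst γ / L ^ γ) ≠ 0 := by simpa using hc
  rcases eq_or_ne (dyadicEnergy γ p a L ω) ∞ with htop | htop
  · rw [htop, ENNReal.mul_top]
    · exact le_top
    · exact (ENNReal.rpow_pos (pos_iff_ne_zero.2 hc0) ENNReal.ofReal_ne_top).ne'
  set B : ℝ := (dyadicEnergy γ p a L ω ^ p⁻¹).toReal with hBdef
  have hBtop : dyadicEnergy γ p a L ω ^ p⁻¹ ≠ ∞ :=
    ENNReal.rpow_ne_top_of_nonneg (by positivity) htop
  have hB : 0 ≤ B := ENNReal.toReal_nonneg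
  have hdy : ∀ m k : ℕ, k < 2 ^ m →
      ‖ω (a + L * ((k + 1) / 2 ^ m)) - ω (a + L * (k / 2 ^ m))‖ ≤ B * ((1 / 2 : ℝ) ^ γ) ^ m := by
    intro m k hk
    set D := ω (a + L * ((k + 1) / 2 ^ m)) - ω (a + L * (k / 2 ^ m)) with hD
    have h1 : ENNReal.ofReal (2 ^ (γ * p * m)) * ‖D‖ₑ ^ p ≤ dyadicEnergy γ p a L ω :=
      (Finset.single_le_sum (f := fun k : ℕ => ENNReal.ofReal (2 ^ (γ * p * m)) *
        ‖ω (a + L * ((k + 1) / 2 ^ m)) - ω (a + L * (k / 2 ^ m))‖ₑ ^ p)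
        (fun _ _ => zero_le) (Finset.mem_range.2 hk)).trans (ENNReal.le_tsum m)
    have h2 : ENNReal.ofReal (2 ^ (γ * m)) * ‖D‖ₑ ≤ dyadicEnergy γ p a L ω ^ p⁻¹ := by
      rw [ENNReal.le_rpow_inv_iff hp, ENNReal.mul_rpow_of_nonneg _ _ hp.le,
        ENNReal.ofReal_rpow_of_nonneg (by positivity) hp.le, ← Real.rpow_mul (by norm_num)]
      convert h1 using 4
      ring
    have h3 := ENNReal.toReal_mono hBtop h2
    rw [ENNReal.toReal_mul, ENNReal.toReal_ofReal (by positivity), toReal_enorm] at h3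
    have h4 : ((1 / 2 : ℝ) ^ γ) ^ m = (2 ^ (γ * m))⁻¹ := by
      rw [one_div, Real.inv_rpow (by norm_num), inv_pow, ← Real.rpow_natCast,
        ← Real.rpow_mul (by norm_num)]
    rw [h4, ← div_eq_mul_inv, le_div_iff₀ (by positivity), mul_comm]
    exact h3
  have hle : holderSeminorm γ a (a + L) ω ≤
      ENNReal.ofReal (chainingConst γ / L ^ γ) * dyadicEnergy γ p a L ω ^ p⁻¹ := by
    rw [← ENNReal.ofReal_toReal hBtop, ← hBdef, ← ENNReal.ofReal_mul hc.le]
    refine iSup_le fun s => iSup_le fun t => iSup_le fun h => ENNReal.div_le_of_le_mul ?_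
    have hts : 0 < t - s := by linarith [h.2.1]
    rw [← ENNReal.ofReal_mul (by positivity), ← ofReal_norm]
    refine ENNReal.ofReal_le_ofReal ?_
    have h1 := norm_sub_le_of_dyadic (f := fun u => ω (a + L * u)) hγ
      ((continuous_path ω).comp (by fun_prop)) hB hdy (s := (s - a) / L) (t := (t - a) / L)
      (div_nonneg (by linarith [h.1]) hL.le) (by gcongr; exact h.2.1)
      ((div_le_one hL).2 (by linarith [h.2.2]))
    have e : ∀ u, a + L * ((u - a) / L) = u := fun u => by field_simp; ring
    rw [e, e, ← sub_div, sub_sub_sub_cancel_right, Real.div_rpow hts.le hL.le] at h1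
    refine h1.trans (le_of_eq ?_)
    ring
  calc holderSeminorm γ a (a + L) ω ^ p
      ≤ (ENNReal.ofReal (chainingConst γ / L ^ γ) * dyadicEnergy γ p a L ω ^ p⁻¹) ^ p := by gcongr
    _ = _ := by
      rw [ENNReal.mul_rpow_of_nonneg _ _ hp.le, ENNReal.rpow_inv_rpow hp.ne']

/-- Level `m` has `2 ^ m` terms of weight `2 ^ (γ * p * m)` and moment of order `2 ^ (-(H * p *
m))`: a geometric series of ratio `2 ^ (1 - (H - γ) * p) < 1`. -/
theorem lintegral_dyadicEnergy_lt_top {P : Measure (PathSpace V)} {K : ℝ≥0∞} {H γ p : ℝ}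
    (hK : K < ∞) (hinc : ∀ s t : ℝ, ∫⁻ ω : PathSpace V, ‖ω t - ω s‖ₑ ^ p ∂P ≤
      ENNReal.ofReal (|t - s| ^ (H * p)) * K)
    (hp : 1 < (H - γ) * p) (a L : ℝ) :
    ∫⁻ ω, dyadicEnergy γ p a L ω ∂P < ∞ := by
  have hmeas : ∀ s t : ℝ, Measurable fun ω : PathSpace V => ‖ω t - ω s‖ₑ ^ p := fun s t =>
    (((continuous_apply_path t).sub (continuous_apply_path s)).enorm.measurable).pow_const p
  have hmeas' : ∀ (c : ℝ≥0∞) (s t : ℝ),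
      Measurable fun ω : PathSpace V => c * ‖ω t - ω s‖ₑ ^ p := fun c s t => (hmeas s t).const_mul c
  set ρ : ℝ := 2 ^ (1 + γ * p - H * p) with hρ
  have hρ1 : ρ < 1 := Real.rpow_lt_one_of_one_lt_of_neg (by norm_num) (by linarith)
  have hρ0 : 0 ≤ ρ := by positivity
  have hterm : ∀ m : ℕ, ∫⁻ ω : PathSpace V, (∑ k ∈ Finset.range (2 ^ m),
      ENNReal.ofReal (2 ^ (γ * p * m)) *
        ‖ω (a + L * ((k + 1) / 2 ^ m)) - ω (a + L * (k / 2 ^ m))‖ₑ ^ p) ∂P ≤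
      ENNReal.ofReal ρ ^ m * (ENNReal.ofReal (|L| ^ (H * p)) * K) := fun m => by
    rw [lintegral_finsetSum _ fun k _ => hmeas' _ _ _]
    have hk : ∀ k ∈ Finset.range (2 ^ m), ∫⁻ ω : PathSpace V, ENNReal.ofReal (2 ^ (γ * p * m)) *
        ‖ω (a + L * ((k + 1) / 2 ^ m)) - ω (a + L * (k / 2 ^ m))‖ₑ ^ p ∂P ≤
        ENNReal.ofReal (2 ^ (γ * p * m)) *
          (ENNReal.ofReal (|L| ^ (H * p) * 2 ^ (-(H * p * m))) * K) := fun k _ => by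
      rw [lintegral_const_mul _ (hmeas _ _)]
      gcongr
      refine (hinc _ _).trans (le_of_eq ?_)
      congr 2
      have e : a + L * (((k : ℝ) + 1) / 2 ^ m) - (a + L * (k / 2 ^ m)) = L * (2 ^ m)⁻¹ := by ring
      rw [e, abs_mul, abs_of_pos (show (0 : ℝ) < (2 ^ m)⁻¹ by positivity),
        Real.mul_rpow (abs_nonneg _) (by positivity), ← Real.rpow_natCast, ← Real.rpow_neg
        (by norm_num), ← Real.rpow_mul (by norm_num)]
      congr 2
      ring
    refine (Finset.sum_le_sum hk).trans (le_of_eq ?_)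
    rw [Finset.sum_const, Finset.card_range, nsmul_eq_mul, ← mul_assoc, ← mul_assoc, ← mul_assoc,
      ← ENNReal.ofReal_pow hρ0, ← ENNReal.ofReal_mul (by positivity)]
    congr 1
    have e2 : ((2 ^ m : ℕ) : ℝ≥0∞) = ENNReal.ofReal ((2 : ℝ) ^ (m : ℝ)) := by
      rw [Real.rpow_natCast, ENNReal.ofReal_pow (by norm_num)]
      simp
    rw [e2, ← ENNReal.ofReal_mul (by positivity), ← ENNReal.ofReal_mul (by positivity)]
    congr 1
    have e3 : ρ ^ m = 2 ^ (m : ℝ) * 2 ^ (γ * p * m) * (2 : ℝ) ^ (-(H * p * m)) := by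
      rw [hρ, ← Real.rpow_natCast, ← Real.rpow_mul (by norm_num), ← Real.rpow_add (by norm_num),
        ← Real.rpow_add (by norm_num)]
      congr 1
      ring
    rw [e3]
    ring
  unfold dyadicEnergy
  rw [lintegral_tsum fun m => (Finset.measurable_sum _ fun k _ => hmeas' _ _ _).aemeasurable]
  refine (ENNReal.tsum_le_tsum hterm).trans_lt ?_
  rw [ENNReal.tsum_mul_right, ENNReal.tsum_geometric]
  refine ENNReal.mul_lt_top ?_ (ENNReal.mul_lt_top ENNReal.ofReal_lt_top hK)
  rw [ENNReal.inv_lt_top, tsub_pos_iff_lt]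
  exact ENNReal.ofReal_lt_one.2 hρ1

end SeminormBound

/-! ### Self-similarity and integrability of the increments. -/

section Moments

variable {V : Type*} [NormedAddCommGroup V] [InnerProductSpace ℝ V] {H : ℝ} {Q : V →L[ℝ] V}
  {P : Measure (PathSpace V)}

theorem IsFBMLaw.variance_inner_smul_sub [IsProbabilityMeasure P] (hP : IsFBMLaw H Q P)
    (hH : 0 < H) (c s t : ℝ) (x : V) :
    Var[fun ω : PathSpace V => inner ℝ x (c • (ω t - ω s)); P] =
      c ^ 2 * |t - s| ^ (2 * H) * inner ℝ (Q x) x := by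
  have hc := fun t z => hP.memLp (coordinate_mem (V := V) t z)
  have e : (fun ω : PathSpace V => inner ℝ x (c • (ω t - ω s))) =
      fun ω : PathSpace V => c * (inner ℝ x (ω t) - inner ℝ x (ω s)) := by
    ext ω
    rw [inner_smul_right, inner_sub_right]
  rw [e, variance_const_mul, variance_fun_sub (hc _ _) (hc _ _),
    ← covariance_self (hc _ _).aemeasurable, ← covariance_self (hc _ _).aemeasurable,
    hP.covariance_eq, hP.covariance_eq, hP.covariance_eq, sub_self, sub_self, abs_zero,
    Real.zero_rpow (by positivity), abs_sub_comm s t]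
  ring

variable [TopologicalSpace.SeparableSpace V]

theorem IsFBMLaw.charFun_map_smul_sub [MeasurableSpace V] [BorelSpace V] (hP : IsFBMLaw H Q P)
    (c s t : ℝ) (x : V) :
    charFun (P.map fun ω : PathSpace V => c • (ω t - ω s)) x =
      Real.exp (-(Var[fun ω : PathSpace V => inner ℝ x (c • (ω t - ω s)); P] / 2)) := by
  have hm : Measurable fun ω : PathSpace V => c • (ω t - ω s) :=
    (((continuous_apply_path t).sub (continuous_apply_path s)).const_smul c).measurable
  have := UniformSpace.secondCountable_of_separable V
  have hmem : (fun ω : PathSpace V => inner ℝ x (c • (ω t - ω s))) ∈ linearFunctionals V := by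
    have := Submodule.smul_mem _ c
      (Submodule.sub_mem _ (coordinate_mem t x) (coordinate_mem s x))
    convert this using 1
    ext ω
    simp [inner_smul_right, inner_sub_right]
  rw [charFun_apply, integral_map hm.aemeasurable (by fun_prop), ← hP.integral_exp hmem]
  simp_rw [real_inner_comm x]

variable [CompleteSpace V]

/-- Increments of fractional Brownian motion scale like `|t - s| ^ H` in every `L^p`. -/
theorem IsFBMLaw.lintegral_enorm_sub [IsProbabilityMeasure P] (hP : IsFBMLaw H Q P)
    (hH : 0 < H) {p : ℝ} (hp : 0 ≤ p) (s t : ℝ) :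
    ∫⁻ ω : PathSpace V, ‖ω t - ω s‖ₑ ^ p ∂P =
      ENNReal.ofReal (|t - s| ^ (H * p)) * ∫⁻ ω : PathSpace V, ‖ω 1 - ω 0‖ₑ ^ p ∂P := by
  borelize V
  have := UniformSpace.secondCountable_of_separable V
  have hm : ∀ c s t : ℝ, Measurable fun ω : PathSpace V => c • (ω t - ω s) := fun c s t =>
    (((continuous_apply_path t).sub (continuous_apply_path s)).const_smul c).measurable
  have hprob : ∀ c s t : ℝ, IsProbabilityMeasure (P.map fun ω : PathSpace V => c • (ω t - ω s)) :=
    fun c s t => Measure.isProbabilityMeasure_map (hm c s t).aemeasurable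
  have hpos : 0 ≤ |t - s| ^ H := by positivity
  -- Self-similarity: both sides are centered Gaussian with the same variance in every direction.
  -- The factor `1` lets one formula serve both.
  have hlaw : P.map (fun ω : PathSpace V => (1 : ℝ) • (ω t - ω s)) =
      P.map (fun ω : PathSpace V => (|t - s| ^ H) • (ω 1 - ω 0)) := by
    refine Measure.ext_of_charFun (funext fun x => ?_)
    rw [hP.charFun_map_smul_sub, hP.charFun_map_smul_sub, hP.variance_inner_smul_sub hH,
      hP.variance_inner_smul_sub hH, ← Real.rpow_natCast, ← Real.rpow_natCast, ← Real.rpow_mul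
      (abs_nonneg _)]
    simp [mul_comm]
  have hmp : Measurable fun v : V => ‖v‖ₑ ^ p := measurable_enorm.pow_const p
  have h1 := lintegral_map hmp (hm 1 s t) (μ := P)
  have h2 := lintegral_map hmp (hm (|t - s| ^ H) 0 1) (μ := P)
  rw [hlaw] at h1
  rw [h1] at h2
  simp only [one_smul, enorm_smul] at h2
  rw [h2, Real.rpow_mul (abs_nonneg _), ← ENNReal.ofReal_rpow_of_nonneg hpos hp,
    ← lintegral_const_mul]
  · refine lintegral_congr fun ω => ?_
    rw [ENNReal.mul_rpow_of_nonneg _ _ hp, Real.enorm_of_nonneg hpos]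
  · exact ((continuous_apply_path 1).sub (continuous_apply_path 0)).enorm.measurable.pow_const p

/-- Fernique's theorem gives finite moments of the increments. -/
theorem IsFBMLaw.lintegral_enorm_sub_lt_top [IsProbabilityMeasure P] (hP : IsFBMLaw H Q P)
    {p : ℝ} (hp : 0 < p) (s t : ℝ) :
    ∫⁻ ω : PathSpace V, ‖ω t - ω s‖ₑ ^ p ∂P < ∞ := by
  borelize V
  have := UniformSpace.secondCountable_of_separable V
  have hm : Measurable fun ω : PathSpace V => ω t - ω s :=
    ((continuous_apply_path t).sub (continuous_apply_path s)).measurable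
  have hg : HasGaussianLaw (fun ω : PathSpace V => ω t - ω s) P := by
    rw [hasGaussianLaw_iff_charFun_map_eq hm.aemeasurable]
    intro x
    have h1 := hP.charFun_map_smul_sub 1 s t x
    simp only [one_smul] at h1
    have h2 : ∫ ω : PathSpace V, inner ℝ x (ω t - ω s) ∂P = 0 := by
      simp only [inner_sub_right]
      exact hP.integral_eq_zero (Submodule.sub_mem _ (coordinate_mem t x) (coordinate_mem s x))
    rw [h1, h2]
    push_cast
    congr 1
    ring
  have h := (hg.memLp (p := ENNReal.ofReal p) ENNReal.ofReal_ne_top).eLpNorm_lt_top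
  have hp0 : ENNReal.ofReal p ≠ 0 := by simpa using hp
  have := lintegral_rpow_enorm_lt_top_of_eLpNorm_lt_top hp0 ENNReal.ofReal_ne_top h
  rwa [ENNReal.toReal_ofReal hp.le] at this

/-- Hölder seminorms of order below the Hurst parameter have all moments. -/
theorem IsFBMLaw.lintegral_holderSeminorm_rpow_lt_top [IsProbabilityMeasure P]
    (hP : IsFBMLaw H Q P) {γ p a b : ℝ} (hγ : 0 < γ) (hγH : γ < H) (hp : 1 < (H - γ) * p)
    (hab : a < b) : ∫⁻ ω, holderSeminorm γ a b ω ^ p ∂P < ∞ := by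
  have hp0 : 0 < p := by
    by_contra h
    nlinarith
  obtain ⟨L, rfl⟩ : ∃ L, b = a + L := ⟨b - a, by ring⟩
  have hL : 0 < L := by linarith
  refine (lintegral_mono fun ω => holderSeminorm_rpow_le hγ hp0 hL ω).trans_lt ?_
  have hc : ENNReal.ofReal (chainingConst γ / L ^ γ) ^ p ≠ ∞ :=
    ENNReal.rpow_ne_top_of_nonneg hp0.le ENNReal.ofReal_ne_top
  rw [lintegral_const_mul' _ _ hc]
  exact ENNReal.mul_lt_top hc.lt_top (lintegral_dyadicEnergy_lt_top
    (hP.lintegral_enorm_sub_lt_top hp0 0 1)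
    (fun s t => (hP.lintegral_enorm_sub (hγ.trans hγH) hp0.le s t).le) hp a L)

end Moments

/-! ### Lower bounds for a single waiting time. -/

section StoppingTimes

variable {V : Type*} [NormedAddCommGroup V] {β' β'' μ : ℝ} {ω : PathSpace V}

/-- Splitting `(t - s) ^ β''` trades the surplus exponent for a power of the interval length. -/
theorem holderSeminorm_le_mul {a b : ℝ} (h : β' ≤ β'') (ω : PathSpace V) :
    holderSeminorm β' a b ω ≤ ENNReal.ofReal ((b - a) ^ (β'' - β')) * holderSeminorm β'' a b ω := by
  refine iSup_le fun s => iSup_le fun t => iSup_le fun hst => ENNReal.div_le_of_le_mul ?_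
  have hts : 0 < t - s := by linarith [hst.2.1]
  have h1 := enorm_sub_le_of_mem (γ := β'') ω hst
  have h0 : ENNReal.ofReal ((t - s) ^ β'') ≠ 0 := by
    simpa using Real.rpow_pos_of_pos hts β''
  rw [ENNReal.div_le_iff h0 ENNReal.ofReal_ne_top] at h1
  refine h1.trans ?_
  have e : (t - s) ^ β'' = (t - s) ^ (β'' - β') * (t - s) ^ β' := by
    rw [← Real.rpow_add hts]
    congr 1
    ring
  rw [e, ENNReal.ofReal_mul (by positivity), mul_comm (ENNReal.ofReal ((b - a) ^ _)), mul_assoc]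
  gcongr
  · linarith [hst.2.2]
  · exact hst.1

/-- The real-valued version of `holderFunctional`, as a function of the seminorm. -/
noncomputable def growth (β' β'' μ h : ℝ) : ℝ := ((h + μ) / μ) ^ (1 / (β'' - β'))

theorem one_le_growth {h : ℝ} (hβ : β' < β'') (hμ : 0 < μ) (hh : 0 ≤ h) :
    1 ≤ growth β' β'' μ h :=
  Real.one_le_rpow ((one_le_div hμ).2 (by linarith)) (by
    have : 0 < β'' - β' := by linarith
    positivity)

theorem growth_mono {h h' : ℝ} (hβ : β' < β'') (hμ : 0 < μ) (hh : 0 ≤ h) (hle : h ≤ h') :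
    growth β' β'' μ h ≤ growth β' β'' μ h' := by
  have : 0 < β'' - β' := sub_pos.2 hβ
  unfold growth
  gcongr

theorem toReal_holderFunctional (hμ : 0 < μ) (hW : windowSeminorm β'' ω ≠ ∞) :
    (holderFunctional β' β'' μ ω).toReal = growth β' β'' μ (windowSeminorm β'' ω).toReal := by
  rw [holderFunctional, growth, ← ENNReal.toReal_rpow, ENNReal.toReal_div,
    ENNReal.toReal_add hW ENNReal.ofReal_ne_top, ENNReal.toReal_ofReal hμ.le]

/-- For `x ≤ 1`, `β'' < 1` lets both terms share the power `x ^ (β'' - β')`, so `μ ≤ x ^ (β'' - β')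
* (h + μ)`, which is solved for `x`. For `x ≥ 1` the bound `growth ≥ 1` suffices. -/
theorem inv_growth_le {h x : ℝ} (hβ : β' < β'') (hβ1 : β'' < 1) (hμ : 0 < μ) (hh : 0 ≤ h)
    (hx : 0 < x) (hle : x ≤ 1 → ENNReal.ofReal μ ≤
      ENNReal.ofReal (x ^ (β'' - β')) * ENNReal.ofReal h + ENNReal.ofReal (μ * x ^ (1 - β'))) :
    (growth β' β'' μ h)⁻¹ ≤ x := by
  have hδ : 0 < β'' - β' := by linarith
  have hg := one_le_growth hβ hμ hh
  rcases le_total 1 x with h1 | h1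
  · exact (inv_le_one_of_one_le₀ hg).trans h1
  · have h2 := hle h1
    rw [← ENNReal.ofReal_mul (by positivity), ← ENNReal.ofReal_add (by positivity) (by positivity),
      ENNReal.ofReal_le_ofReal_iff (by positivity)] at h2
    have h3 : x ^ (1 - β') ≤ x ^ (β'' - β') :=
      Real.rpow_le_rpow_of_exponent_ge hx h1 (by linarith)
    have h4 : μ ≤ x ^ (β'' - β') * (h + μ) := by nlinarith
    have h5 : ((h + μ) / μ)⁻¹ ≤ x ^ (β'' - β') := by
      rw [inv_div, div_le_iff₀ (by linarith)]
      exact h4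
    rw [growth, ← Real.inv_rpow (by positivity), one_div]
    calc ((h + μ) / μ)⁻¹ ^ (β'' - β')⁻¹ ≤ (x ^ (β'' - β')) ^ (β'' - β')⁻¹ := by gcongr
      _ = x := Real.rpow_rpow_inv hx.le hδ.ne'

theorem inv_growth_le_forwardTime {h : ℝ} (hβ : β' < β'') (hβ1 : β'' < 1) (hμ : 0 < μ)
    (hh : 0 ≤ h) (hω : holderSeminorm β'' 0 1 ω ≤ ENNReal.ofReal h) :
    (growth β' β'' μ h)⁻¹ ≤ forwardTime β' μ ω := by
  refine le_csInf ⟨1, one_pos, by simp⟩ fun τ hτ => inv_growth_le hβ hβ1 hμ hh hτ.1 fun h1 => ?_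
  refine hτ.2.trans (add_le_add ?_ le_rfl)
  refine (holderSeminorm_le_mul hβ.le ω).trans ?_
  rw [sub_zero]
  gcongr
  exact (holderSeminorm_mono ω le_rfl h1).trans hω

theorem backwardTime_le_neg_inv_growth {h : ℝ} (hβ : β' < β'') (hβ1 : β'' < 1) (hμ : 0 < μ)
    (hh : 0 ≤ h) (hω : holderSeminorm β'' (-1) 0 ω ≤ ENNReal.ofReal h) :
    backwardTime β' μ ω ≤ -(growth β' β'' μ h)⁻¹ := by
  refine csSup_le ⟨-1, by norm_num, by simp⟩ fun τ hτ => ?_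
  have hτ0 : 0 < -τ := neg_pos.2 hτ.1
  refine le_neg_of_le_neg (inv_growth_le hβ hβ1 hμ hh hτ0 fun h1 => ?_)
  have h2 := hτ.2
  rw [abs_of_neg hτ.1] at h2
  refine h2.trans (add_le_add ?_ le_rfl)
  refine (holderSeminorm_le_mul hβ.le ω).trans ?_
  rw [zero_sub]
  gcongr
  exact (holderSeminorm_mono ω (by linarith) le_rfl).trans hω

/-- The deterministic term alone reaches the threshold at `τ = -1`. Steps of length at most 1 are
what keeps each step inside a single window. -/
theorem neg_one_le_backwardTime : -1 ≤ backwardTime β' μ ω :=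
  le_csSup ⟨0, fun _ hτ => hτ.1.le⟩ ⟨by norm_num, by simp⟩

end StoppingTimes

/-! ### Pathwise analysis of the stopping times. -/

section HolderPaths

variable {V : Type*} [NormedAddCommGroup V] {β' β'' μ : ℝ} {ω : PathSpace V}

theorem holderSeminorm_lt_top (hω : ω ∈ holderPaths β'') (a b : ℝ) :
    holderSeminorm β'' a b ω < ∞ := by
  obtain ⟨k, hk⟩ := exists_nat_ge (max |a| |b|)
  refine (holderSeminorm_mono ω ?_ ?_).trans_lt (hω k)
  · linarith [neg_abs_le a, le_max_left |a| |b|]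
  · linarith [le_abs_self b, le_max_right |a| |b|]

theorem windowSeminorm_shift_lt_top (hω : ω ∈ holderPaths β'') (q : ℝ) :
    windowSeminorm β'' (shift q ω) < ∞ :=
  (windowSeminorm_shift_le β'' q ω).trans_lt (holderSeminorm_lt_top hω _ _)

/-- The process `q ↦ F (θ_q ω)` with values in `ℝ`. -/
noncomputable def functionalPath (β' β'' μ : ℝ) (ω : PathSpace V) (q : ℝ) : ℝ :=
  (holderFunctional β' β'' μ (shift q ω)).toReal

theorem functionalPath_shift (t q : ℝ) :
    functionalPath β' β'' μ (shift t ω) q = functionalPath β' β'' μ ω (t + q) := by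
  rw [functionalPath, functionalPath, shift_shift]

theorem functionalPath_nonneg (q : ℝ) : 0 ≤ functionalPath β' β'' μ ω q := ENNReal.toReal_nonneg

theorem functionalPath_eq (hμ : 0 < μ) (hω : ω ∈ holderPaths β'') (q : ℝ) :
    functionalPath β' β'' μ ω q =
      growth β' β'' μ (windowSeminorm β'' (shift q ω)).toReal :=
  toReal_holderFunctional hμ (windowSeminorm_shift_lt_top hω q).ne

theorem one_le_functionalPath (hβ : β' < β'') (hμ : 0 < μ) (hω : ω ∈ holderPaths β'') (q : ℝ) :
    1 ≤ functionalPath β' β'' μ ω q := by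
  rw [functionalPath_eq hμ hω]
  exact one_le_growth hβ hμ ENNReal.toReal_nonneg

theorem intervalIntegrable_functionalPath (hβ : β' < β'') (hμ : 0 < μ) (hω : ω ∈ holderPaths β'')
    (a b : ℝ) : IntervalIntegrable (functionalPath β' β'' μ ω) volume a b := by
  have hm : Measurable (functionalPath β' β'' μ ω) :=
    ((measurable_holderFunctional β' β'' μ).comp (continuous_shift_left ω).measurable).ennreal_toReal
  set C := growth β' β'' μ (holderSeminorm β'' (min a b - 1) (max a b + 1) ω).toReal
  refine (intervalIntegrable_const (c := C)).mono_fun hm.aestronglyMeasurable ?_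
  refine (ae_restrict_iff' measurableSet_uIoc).2 (.of_forall fun q hq => ?_)
  have hq' : q ∈ uIcc a b := uIoc_subset_uIcc hq
  beta_reduce
  rw [Real.norm_of_nonneg (functionalPath_nonneg q), functionalPath_eq hμ hω]
  refine le_trans ?_ (le_abs_self _)
  refine growth_mono hβ hμ ENNReal.toReal_nonneg
    (ENNReal.toReal_mono (holderSeminorm_lt_top hω _ _).ne ?_)
  exact (windowSeminorm_shift_le β'' q ω).trans
    (holderSeminorm_mono ω (by linarith [hq'.1]) (by linarith [hq'.2]))

/-- The member `r = 1` of the window at `q` is the interval `[q, q + 1]`, so the backward-looking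
`F` also controls the forward wait. -/
theorem inv_functionalPath_le_forwardTime (hβ : β' < β'') (hβ1 : β'' < 1) (hμ : 0 < μ)
    (hω : ω ∈ holderPaths β'') (q : ℝ) :
    (functionalPath β' β'' μ ω q)⁻¹ ≤ forwardTime β' μ (shift q ω) := by
  rw [functionalPath_eq hμ hω]
  refine inv_growth_le_forwardTime hβ hβ1 hμ ENNReal.toReal_nonneg ?_
  rw [ENNReal.ofReal_toReal (windowSeminorm_shift_lt_top hω q).ne, holderSeminorm_shift, add_zero]
  simpa using le_windowSeminorm_shift (γ := β'') (q := q) (u := q + 1) ω ⟨by linarith, le_rfl⟩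

theorem forwardTime_shift_pos (hβ : β' < β'') (hβ1 : β'' < 1) (hμ : 0 < μ)
    (hω : ω ∈ holderPaths β'') (q : ℝ) : 0 < forwardTime β' μ (shift q ω) :=
  (inv_pos.2 (one_pos.trans_le (one_le_functionalPath hβ hμ hω q))).trans_le
    (inv_functionalPath_le_forwardTime hβ hβ1 hμ hω q)

theorem backwardTime_shift_le (hβ : β' < β'') (hβ1 : β'' < 1) (hμ : 0 < μ)
    (hω : ω ∈ holderPaths β'') {u q : ℝ} (hu : u ∈ Icc q (q + 1)) :
    backwardTime β' μ (shift u ω) ≤ -(functionalPath β' β'' μ ω q)⁻¹ := by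
  rw [functionalPath_eq hμ hω]
  refine backwardTime_le_neg_inv_growth hβ hβ1 hμ ENNReal.toReal_nonneg ?_
  rw [ENNReal.ofReal_toReal (windowSeminorm_shift_lt_top hω q).ne, holderSeminorm_shift, add_zero]
  exact le_windowSeminorm_shift ω hu

theorem backwardTime_shift_neg (hβ : β' < β'') (hβ1 : β'' < 1) (hμ : 0 < μ)
    (hω : ω ∈ holderPaths β'') (u : ℝ) : backwardTime β' μ (shift u ω) < 0 :=
  (backwardTime_shift_le hβ hβ1 hμ hω (q := u) ⟨le_rfl, by linarith⟩).trans_lt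
    (neg_neg_of_pos (inv_pos.2 (one_pos.trans_le (one_le_functionalPath hβ hμ hω u))))

theorem neg_natCast_le_backwardSeq (n : ℕ) : -(n : ℝ) ≤ backwardSeq β' μ ω n := by
  induction n with
  | zero => simp [backwardSeq]
  | succ n ih =>
    have := neg_one_le_backwardTime (β' := β') (μ := μ) (ω := shift (backwardSeq β' μ ω n) ω)
    rw [backwardSeq]
    push_cast
    linarith

theorem backwardSeq_antitone (hβ : β' < β'') (hβ1 : β'' < 1) (hμ : 0 < μ)
    (hω : ω ∈ holderPaths β'') : Antitone (backwardSeq β' μ ω) :=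
  antitone_nat_of_succ_le fun n => by
    rw [backwardSeq]
    linarith [backwardTime_shift_neg hβ hβ1 hμ hω (backwardSeq β' μ ω n)]

/-- Every `q` in the step has `u ∈ [q, q + 1]`, so the integrand dominates the inverse of the step
length throughout the step. -/
theorem one_le_integral_backwardTime (hβ : β' < β'') (hβ1 : β'' < 1) (hμ : 0 < μ)
    (hω : ω ∈ holderPaths β'') (u : ℝ) :
    1 ≤ ∫ q in (u + backwardTime β' μ (shift u ω))..u, functionalPath β' β'' μ ω q := by
  set τ := backwardTime β' μ (shift u ω) with hτ
  have hτ0 : τ < 0 := backwardTime_shift_neg hβ hβ1 hμ hω u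
  have hτ1 : -1 ≤ τ := neg_one_le_backwardTime
  have h1 : ∫ _ in (u + τ)..u, (-τ)⁻¹ = 1 := by
    rw [intervalIntegral.integral_const, smul_eq_mul]
    rw [sub_add_cancel_left]
    exact mul_inv_cancel₀ (by linarith)
  rw [← h1]
  refine intervalIntegral.integral_mono_on (by linarith) intervalIntegrable_const
    (intervalIntegrable_functionalPath hβ hμ hω _ _) fun q hq => ?_
  have h2 := backwardTime_shift_le hβ hβ1 hμ hω (q := q) (u := u)
    ⟨hq.2, by linarith [hq.1]⟩
  have h3 := one_le_functionalPath hβ hμ hω q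
  exact inv_le_of_inv_le₀ (by linarith) (by linarith)

theorem natCast_le_integral_backwardSeq (hβ : β' < β'') (hβ1 : β'' < 1) (hμ : 0 < μ)
    (hω : ω ∈ holderPaths β'') (n : ℕ) :
    n ≤ ∫ q in (backwardSeq β' μ ω n)..0, functionalPath β' β'' μ ω q := by
  induction n with
  | zero => simp [backwardSeq]
  | succ n ih =>
    rw [← intervalIntegral.integral_add_adjacent_intervals (b := backwardSeq β' μ ω n)
      (intervalIntegrable_functionalPath hβ hμ hω _ _)
      (intervalIntegrable_functionalPath hβ hμ hω _ _), backwardSeq]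
    have := one_le_integral_backwardTime hβ hβ1 hμ hω (backwardSeq β' μ ω n)
    push_cast
    linarith

/-- Were the sequence to stay above some `b`, the finite integral of `F` over `[b, 0]` would exceed
every `n`. -/
theorem tendsto_backwardSeq (hβ : β' < β'') (hβ1 : β'' < 1) (hμ : 0 < μ)
    (hω : ω ∈ holderPaths β'') : Tendsto (backwardSeq β' μ ω) atTop atBot := by
  refine tendsto_atTop_atBot_of_antitone (backwardSeq_antitone hβ hβ1 hμ hω) fun b => ?_
  by_contra! hcon
  obtain ⟨n, hn⟩ := exists_nat_gt (∫ q in b..0, functionalPath β' β'' μ ω q)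
  have h1 := natCast_le_integral_backwardSeq hβ hβ1 hμ hω n
  have h2 : 0 ≤ ∫ q in b..(backwardSeq β' μ ω n), functionalPath β' β'' μ ω q :=
    intervalIntegral.integral_nonneg (hcon n).le fun q _ => functionalPath_nonneg q
  rw [← intervalIntegral.integral_add_adjacent_intervals (b := backwardSeq β' μ ω n)
    (intervalIntegrable_functionalPath hβ hμ hω _ _)
    (intervalIntegrable_functionalPath hβ hμ hω _ _)] at hn
  linarith

theorem tendsto_neg_toNat_atBot : Tendsto (fun k : ℤ => (-k).toNat) atBot atTop :=
  tendsto_atTop.2 fun n => by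
    filter_upwards [eventually_le_atBot (-(n : ℤ))] with k hk
    omega

theorem stoppingTime_eq_backwardSeq {k : ℤ} (hk : k < 0) :
    stoppingTime β' μ k ω = backwardSeq β' μ ω (-k).toNat := by
  rw [stoppingTime, if_neg (not_le.2 hk)]

theorem tendsto_stoppingTime (hβ : β' < β'') (hβ1 : β'' < 1) (hμ : 0 < μ)
    (hω : ω ∈ holderPaths β'') : Tendsto (fun k : ℤ => stoppingTime β' μ k ω) atBot atBot := by
  refine ((tendsto_backwardSeq hβ hβ1 hμ hω).comp tendsto_neg_toNat_atBot).congr' ?_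
  filter_upwards [eventually_lt_atBot 0] with k hk
  exact (stoppingTime_eq_backwardSeq hk).symm

theorem abs_intCast_le_integral (hβ : β' < β'') (hβ1 : β'' < 1) (hμ : 0 < μ)
    (hω : ω ∈ holderPaths β'') {k : ℤ} (hk : k < 0) :
    -(k : ℝ) ≤ ∫ q in (stoppingTime β' μ k ω)..0, functionalPath β' β'' μ ω q := by
  rw [stoppingTime_eq_backwardSeq hk]
  refine le_trans (le_of_eq ?_) (natCast_le_integral_backwardSeq hβ hβ1 hμ hω (-k).toNat)
  have : (((-k).toNat : ℤ) : ℝ) = ((-k : ℤ) : ℝ) := by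
    rw [Int.toNat_of_nonneg (by omega)]
  push_cast at this
  exact this.symm

theorem intCast_le_stoppingTime {k : ℤ} (hk : k < 0) : (k : ℝ) ≤ stoppingTime β' μ k ω := by
  rw [stoppingTime_eq_backwardSeq hk]
  refine le_trans (le_of_eq ?_) (neg_natCast_le_backwardSeq (-k).toNat)
  have : (((-k).toNat : ℤ) : ℝ) = ((-k : ℤ) : ℝ) := by
    rw [Int.toNat_of_nonneg (by omega)]
  push_cast at this
  linarith

/-- The asymptotic density of the backward stopping times. -/
theorem inv_le_liminf_stoppingTime (hβ : β' < β'') (hβ1 : β'' < 1) (hμ : 0 < μ)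
    (hω : ω ∈ holderPaths β'') {m : ℝ} (hm : 0 < m)
    (hlim : Tendsto (fun t : ℝ => 1 / t * ∫ q in (0 : ℝ)..t, functionalPath β' β'' μ ω q)
      atBot (𝓝 m)) :
    ((m⁻¹ : ℝ) : EReal) ≤
      liminf (fun k : ℤ => ((stoppingTime β' μ k ω / (k : ℝ) : ℝ) : EReal)) atBot := by
  have hT := tendsto_stoppingTime hβ hβ1 hμ hω
  have h1 := (hlim.comp hT).inv₀ hm.ne'
  have h2 := (continuous_coe_real_ereal.tendsto m⁻¹).comp h1
  rw [← h2.liminf_eq]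
  refine liminf_le_liminf ?_
  filter_upwards [eventually_lt_atBot 0, hT.eventually_lt_atBot 0] with k hk hTk
  simp only [Function.comp_apply, EReal.coe_le_coe_iff]
  have hk' : (k : ℝ) < 0 := by exact_mod_cast hk
  have h3 := abs_intCast_le_integral hβ hβ1 hμ hω hk
  rw [intervalIntegral.integral_symm (0 : ℝ)] at h3
  set I := ∫ q in (0 : ℝ)..(stoppingTime β' μ k ω), functionalPath β' β'' μ ω q
  have hI : I ≤ k := by linarith
  -- Since `I ≤ k < 0` and `T_k < 0`, flipping signs leaves `|T_k| / |I| ≤ |T_k| / |k|`.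
  rw [mul_inv, one_div, inv_inv, ← div_eq_mul_inv, ← neg_div_neg_eq, ← neg_div_neg_eq _ (k : ℝ)]
  exact div_le_div_of_nonneg_left (by linarith) (by linarith) (by linarith)

theorem tendsto_log_div_atTop (hμ : 0 < μ) :
    Tendsto (fun x : ℝ => Real.log ((x + μ) / μ) / x) atTop (𝓝 0) := by
  have h := Real.tendsto_pow_log_div_mul_add_atTop μ (-μ) 1 hμ.ne'
  have h1 : Tendsto (fun x : ℝ => (x + μ) / μ) atTop atTop :=
    (tendsto_atTop_add_const_right _ μ tendsto_id).atTop_div_const hμ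
  refine (h.comp h1).congr fun x => ?_
  simp only [Function.comp_apply, pow_one]
  congr 1
  field_simp
  ring

/-- The inverse waiting times grow subexponentially. -/
theorem tendsto_posLog_forwardTime {β : ℝ} (hβ0 : 0 < β) (hβ : β' < β'') (hβ1 : β'' < 1)
    (hμ : 0 < μ) (hω : ω ∈ holderPaths β'')
    (hsub : Tendsto (fun t : ℝ => windowSeminorm β'' (shift t ω) / ENNReal.ofReal |t|)
      atBot (𝓝 0)) :
    Tendsto (fun i : ℤ => Real.posLog (|forwardTime β' μ
      (shift (stoppingTime β' μ i ω) ω)| ^ (-β)) / |(i : ℝ)|) atBot (𝓝 0) := by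
  have hT := tendsto_stoppingTime hβ hβ1 hμ hω
  have habs : Tendsto (fun i : ℤ => |(i : ℝ)|) atBot atTop :=
    tendsto_abs_atBot_atTop.comp (tendsto_intCast_atBot_iff.2 tendsto_id)
  have hup := (((tendsto_log_div_atTop hμ).comp habs).const_mul (1 / (β'' - β'))).const_mul β
  simp only [mul_zero] at hup
  refine tendsto_of_tendsto_of_tendsto_of_le_of_le' tendsto_const_nhds hup
    (.of_forall fun i => div_nonneg Real.posLog_nonneg (abs_nonneg _)) ?_
  -- Sublinearity is needed only with constant 1: eventually the window seminorm at `T_i` is at most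
  -- `|T_i| ≤ |i|`.
  filter_upwards [eventually_lt_atBot 0, hT.eventually_lt_atBot 0,
    (hsub.comp hT).eventually_le_const (show (0 : ℝ≥0∞) < 1 by norm_num)] with i hi hTi hWi
  set s := stoppingTime β' μ i ω with hs
  have hi' : (i : ℝ) < 0 := by exact_mod_cast hi
  have hsi : |s| ≤ |(i : ℝ)| := by
    rw [abs_of_neg hTi, abs_of_neg hi']
    linarith [intCast_le_stoppingTime (β' := β') (μ := μ) (ω := ω) hi]
  have hs0 : 0 < |s| := abs_pos.2 hTi.ne
  have hW : (windowSeminorm β'' (shift s ω)).toReal ≤ |(i : ℝ)| := by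
    refine le_trans ?_ hsi
    simp only [Function.comp_apply] at hWi
    rw [ENNReal.div_le_iff (by simpa using hs0) ENNReal.ofReal_ne_top, one_mul] at hWi
    exact ENNReal.toReal_le_of_le_ofReal hs0.le hWi
  set F := functionalPath β' β'' μ ω s with hF
  have hF1 : 1 ≤ F := one_le_functionalPath hβ hμ hω s
  have hFle : F ≤ ((|(i : ℝ)| + μ) / μ) ^ (1 / (β'' - β')) := by
    rw [hF, functionalPath_eq hμ hω]
    exact growth_mono hβ hμ ENNReal.toReal_nonneg hW
  have hTpos := forwardTime_shift_pos hβ hβ1 hμ hω s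
  have hTF := inv_functionalPath_le_forwardTime hβ hβ1 hμ hω s
  have h1 : |forwardTime β' μ (shift s ω)| ^ (-β) ≤ F ^ β := by
    rw [abs_of_pos hTpos, Real.rpow_neg hTpos.le, ← Real.inv_rpow hTpos.le]
    exact Real.rpow_le_rpow (by positivity) (inv_le_of_inv_le₀ (by linarith) hTF) hβ0.le
  have h2 : Real.posLog (|forwardTime β' μ (shift s ω)| ^ (-β)) ≤
      β * (1 / (β'' - β') * Real.log ((|(i : ℝ)| + μ) / μ)) := by
    have hpos : (0 : ℝ) < (|(i : ℝ)| + μ) / μ := by positivity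
    calc Real.posLog (|forwardTime β' μ (shift s ω)| ^ (-β)) ≤ Real.posLog (F ^ β) :=
          Real.posLog_le_posLog (by positivity) h1
      _ = β * Real.log F := by
          rw [Real.posLog_eq_log, Real.log_rpow (by linarith)]
          rw [abs_of_nonneg (by positivity)]
          exact Real.one_le_rpow hF1 hβ0.le
      _ ≤ β * (1 / (β'' - β') * Real.log ((|(i : ℝ)| + μ) / μ)) := by
          rw [← Real.log_rpow hpos]
          gcongr
  simp only [Function.comp_apply]
  calc Real.posLog (|forwardTime β' μ (shift s ω)| ^ (-β)) / |(i : ℝ)|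
      ≤ β * (1 / (β'' - β') * Real.log ((|(i : ℝ)| + μ) / μ)) / |(i : ℝ)| := by gcongr
    _ = _ := by ring

end HolderPaths

/-! ### From integer limits to real limits. -/

section RealLimits

/-- Averages of a monotone function converge along the reals if they do along the integers. -/
theorem tendsto_div_of_monotone_of_natCast {A : ℝ → ℝ} (hA : Monotone A) {c : ℝ}
    (h : Tendsto (fun n : ℕ => A n / n) atTop (𝓝 c)) : Tendsto (fun t => A t / t) atTop (𝓝 c) := by
  have hfl : Tendsto (fun t : ℝ => ⌊t⌋₊) atTop atTop := tendsto_nat_floor_atTop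
  have hr : Tendsto (fun t : ℝ => (⌊t⌋₊ : ℝ) / t) atTop (𝓝 1) := tendsto_nat_floor_div_atTop
  have hr' : Tendsto (fun t : ℝ => ((⌊t⌋₊ + 1 : ℕ) : ℝ) / t) atTop (𝓝 1) := by
    have := hr.add tendsto_inv_atTop_zero
    rw [add_zero] at this
    refine this.congr fun t => ?_
    push_cast
    rw [add_div, one_div]
  have hlo : Tendsto (fun t : ℝ => A ⌊t⌋₊ / t) atTop (𝓝 c) := by
    have := (h.comp hfl).mul hr
    rw [mul_one] at this
    refine this.congr' ?_
    filter_upwards [eventually_ge_atTop 1] with t ht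
    have : (⌊t⌋₊ : ℝ) ≠ 0 := by exact_mod_cast (Nat.floor_pos.2 ht).ne'
    simp only [Function.comp_apply]
    field_simp
  have hup : Tendsto (fun t : ℝ => A (⌊t⌋₊ + 1 : ℕ) / t) atTop (𝓝 c) := by
    have := (((tendsto_add_atTop_iff_nat 1).2 h).comp hfl).mul hr'
    rw [mul_one] at this
    refine this.congr fun t => ?_
    simp only [Function.comp_apply]
    have : ((⌊t⌋₊ + 1 : ℕ) : ℝ) ≠ 0 := by positivity
    field_simp
  refine tendsto_of_tendsto_of_tendsto_of_le_of_le' hlo hup ?_ ?_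
  · filter_upwards [eventually_gt_atTop 0] with t ht
    have := hA (Nat.floor_le ht.le)
    gcongr
  · filter_upwards [eventually_gt_atTop 0] with t ht
    have := hA (Nat.lt_floor_add_one t).le
    push_cast
    gcongr

/-- Sublinear growth along the integers implies sublinear growth along the reals for functions
controlled by their values at neighbouring integers. -/
theorem tendsto_div_ofReal_of_natCast {w : ℝ → ℝ≥0∞}
    (hw : ∀ (n : ℕ) (t : ℝ), t ∈ Icc (n : ℝ) (n + 1) → w t ≤ max (w n) (w (n + 1 : ℕ)))
    (h : Tendsto (fun n : ℕ => w n / n) atTop (𝓝 0)) :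
    Tendsto (fun t => w t / ENNReal.ofReal |t|) atTop (𝓝 0) := by
  have hfl : Tendsto (fun t : ℝ => ⌊t⌋₊) atTop atTop := tendsto_nat_floor_atTop
  -- The factor 2 pays for `⌊t⌋ + 1 ≤ 2 * t` when `t ≥ 1`.
  have h2 : Tendsto (fun n : ℕ => w n / n + 2 * (w (n + 1 : ℕ) / (n + 1 : ℕ))) atTop (𝓝 0) := by
    have := h.add (ENNReal.Tendsto.const_mul ((tendsto_add_atTop_iff_nat 1).2 h)
      (Or.inr (by norm_num : (2 : ℝ≥0∞) ≠ ∞)))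
    simpa using this
  refine tendsto_of_tendsto_of_tendsto_of_le_of_le' tendsto_const_nhds (h2.comp hfl)
    (.of_forall fun _ => zero_le) ?_
  filter_upwards [eventually_ge_atTop 1] with t ht
  have ht0 : 0 ≤ t := by linarith
  have hn1 : 1 ≤ ⌊t⌋₊ := Nat.floor_pos.2 ht
  have hle := hw ⌊t⌋₊ t ⟨Nat.floor_le ht0, (Nat.lt_floor_add_one t).le⟩
  have hden : ((⌊t⌋₊ : ℕ) : ℝ≥0∞) ≤ ENNReal.ofReal |t| := by
    rw [abs_of_nonneg ht0, ← ENNReal.ofReal_natCast]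
    exact ENNReal.ofReal_le_ofReal (Nat.floor_le ht0)
  have hden2 : ((⌊t⌋₊ + 1 : ℕ) : ℝ≥0∞) ≤ 2 * ENNReal.ofReal |t| := by
    refine le_trans ?_ (mul_le_mul_right hden 2)
    exact_mod_cast (by omega : ⌊t⌋₊ + 1 ≤ 2 * ⌊t⌋₊)
  simp only [Function.comp_apply]
  calc w t / ENNReal.ofReal |t| ≤ (w ⌊t⌋₊ + w (⌊t⌋₊ + 1 : ℕ)) / ENNReal.ofReal |t| := by
        gcongr
        exact hle.trans (max_le le_self_add le_add_self)
    _ = w ⌊t⌋₊ / ENNReal.ofReal |t| + 2 * (w (⌊t⌋₊ + 1 : ℕ) / (2 * ENNReal.ofReal |t|)) := by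
        rw [ENNReal.add_div, ← mul_div_assoc,
          ENNReal.mul_div_mul_left _ _ (by norm_num) (by norm_num)]
    _ ≤ _ := by gcongr

end RealLimits

/-! ### Measurability and shift invariance of the good set. -/

section GoodPaths

variable {V : Type*} [NormedAddCommGroup V] {β' β'' μ : ℝ} {ω : PathSpace V}

/-- As `F ≥ 0`, the integral is monotone in its endpoint, so integer times decide the limit. -/
theorem natCast_tendsto_atTop_iff (hβ : β' < β'') (hμ : 0 < μ) (hω : ω ∈ holderPaths β'')
    (c : ℝ) :
    Tendsto (fun t : ℝ => 1 / t * ∫ q in (0 : ℝ)..t, functionalPath β' β'' μ ω q) atTop (𝓝 c) ↔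
      Tendsto (fun n : ℕ => (∫ q in (0 : ℝ)..n, functionalPath β' β'' μ ω q) / n) atTop (𝓝 c) := by
  simp_rw [one_div_mul_eq_div]
  refine ⟨fun h => h.comp tendsto_natCast_atTop_atTop, fun h => ?_⟩
  refine tendsto_div_of_monotone_of_natCast
    (A := fun t => ∫ q in (0 : ℝ)..t, functionalPath β' β'' μ ω q) (fun s t hst => ?_) h
  have hI := intervalIntegrable_functionalPath hβ hμ hω
  beta_reduce
  rw [← sub_nonneg, intervalIntegral.integral_interval_sub_left (hI _ _) (hI _ _)]
  exact intervalIntegral.integral_nonneg hst fun q _ => functionalPath_nonneg q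

theorem natCast_tendsto_atBot_iff (hβ : β' < β'') (hμ : 0 < μ) (hω : ω ∈ holderPaths β'')
    (c : ℝ) :
    Tendsto (fun t : ℝ => 1 / t * ∫ q in (0 : ℝ)..t, functionalPath β' β'' μ ω q) atBot (𝓝 c) ↔
      Tendsto (fun n : ℕ => (∫ q in (-n : ℝ)..0, functionalPath β' β'' μ ω q) / n)
        atTop (𝓝 c) := by
  have e : ∀ t : ℝ, 1 / -t * ∫ q in (0 : ℝ)..(-t), functionalPath β' β'' μ ω q =
      (∫ q in (-t)..0, functionalPath β' β'' μ ω q) / t := fun t => by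
    rw [intervalIntegral.integral_symm (-t) 0, one_div_mul_eq_div, neg_div_neg_eq]
  have e2 : Tendsto (fun t : ℝ => 1 / t * ∫ q in (0 : ℝ)..t, functionalPath β' β'' μ ω q)
      atBot (𝓝 c) ↔
      Tendsto (fun t : ℝ => (∫ q in (-t)..0, functionalPath β' β'' μ ω q) / t) atTop (𝓝 c) := by
    simp_rw [← e]
    exact ⟨fun h => h.comp tendsto_neg_atTop_atBot, fun h => by
      simpa [Function.comp_def] using h.comp tendsto_neg_atBot_atTop⟩
  rw [e2]
  refine ⟨fun h => h.comp tendsto_natCast_atTop_atTop, fun h => ?_⟩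
  refine tendsto_div_of_monotone_of_natCast
    (A := fun t => ∫ q in (-t)..0, functionalPath β' β'' μ ω q) (fun s t hst => ?_) h
  have hI := intervalIntegrable_functionalPath hβ hμ hω
  beta_reduce
  rw [← intervalIntegral.integral_add_adjacent_intervals (hI (-t) (-s)) (hI (-s) 0)]
  refine le_add_of_nonneg_left ?_
  exact intervalIntegral.integral_nonneg (by linarith) fun q _ => functionalPath_nonneg q

theorem windowSeminorm_natCast_tendsto_atTop_iff (ω : PathSpace V) :
    Tendsto (fun t : ℝ => windowSeminorm β'' (shift t ω) / ENNReal.ofReal |t|) atTop (𝓝 0) ↔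
      Tendsto (fun n : ℕ => windowSeminorm β'' (shift (n : ℝ) ω) / n) atTop (𝓝 0) := by
  refine ⟨fun h => ?_, fun h => ?_⟩
  · simpa [Function.comp_def] using h.comp tendsto_natCast_atTop_atTop
  · refine tendsto_div_ofReal_of_natCast (w := fun t => windowSeminorm β'' (shift t ω))
      (fun n t ht => ?_) h
    push_cast
    exact windowSeminorm_shift_le_max ω ht

theorem windowSeminorm_natCast_tendsto_atBot_iff (ω : PathSpace V) :
    Tendsto (fun t : ℝ => windowSeminorm β'' (shift t ω) / ENNReal.ofReal |t|) atBot (𝓝 0) ↔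
      Tendsto (fun n : ℕ => windowSeminorm β'' (shift (-(n : ℝ)) ω) / n) atTop (𝓝 0) := by
  refine ⟨fun h => ?_, fun h => ?_⟩
  · simpa [Function.comp_def] using
      h.comp (tendsto_neg_atTop_atBot.comp tendsto_natCast_atTop_atTop)
  · have := (tendsto_div_ofReal_of_natCast (w := fun t => windowSeminorm β'' (shift (-t) ω))
      (fun n t ht => ?_) h).comp tendsto_neg_atBot_atTop
    · simpa [Function.comp_def] using this
    · push_cast
      have h2 := windowSeminorm_shift_le_max (γ := β'') (q := -t) (n := -(n + 1 : ℝ)) ω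
        ⟨by linarith [ht.2], by linarith [ht.1]⟩
      rw [max_comm, show -((n : ℝ) + 1) + 1 = -n by ring] at h2
      exact h2

/-- The set of good paths, described by limits along the integers. -/
theorem goodPaths_eq (hβ : β' < β'') (hμ : 0 < μ) (P : Measure (PathSpace V)) :
    goodPaths β' β'' μ P =
      holderPaths β'' ∩
      ({ω | Tendsto (fun n : ℕ => (∫ q in (0 : ℝ)..n, functionalPath β' β'' μ ω q) / n) atTop
        (𝓝 (holderMean β' β'' μ P).toReal)} ∩
      {ω | Tendsto (fun n : ℕ => (∫ q in (-n : ℝ)..0, functionalPath β' β'' μ ω q) / n) atTop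
        (𝓝 (holderMean β' β'' μ P).toReal)} ∩
      ({ω | Tendsto (fun n : ℕ => windowSeminorm β'' (shift (n : ℝ) ω) / n) atTop (𝓝 0)} ∩
      {ω | Tendsto (fun n : ℕ => windowSeminorm β'' (shift (-(n : ℝ)) ω) / n) atTop (𝓝 0)})) := by
  ext ω
  simp only [goodPaths, mem_inter_iff, mem_ofPred_eq, ergodicPaths, sublinearPaths,
    mem_insert_iff, mem_singleton_iff, forall_eq_or_imp, forall_eq]
  rw [and_comm]
  refine and_congr_right fun hω => ?_
  rw [← natCast_tendsto_atTop_iff hβ hμ hω, ← natCast_tendsto_atBot_iff hβ hμ hω,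
    ← windowSeminorm_natCast_tendsto_atTop_iff, ← windowSeminorm_natCast_tendsto_atBot_iff]
  rfl

theorem measurableSet_holderPaths : MeasurableSet (holderPaths β'' : Set (PathSpace V)) := by
  have : (holderPaths β'' : Set (PathSpace V)) =
      ⋂ k : ℕ, {ω | holderSeminorm β'' (-(k : ℝ)) k ω < ∞} := by
    ext ω
    simp [holderPaths]
  rw [this]
  exact .iInter fun k => measurableSet_lt (measurable_holderSeminorm _ _ _) measurable_const

theorem measurable_functionalPath_uncurry [TopologicalSpace.SeparableSpace V] :
    Measurable fun p : PathSpace V × ℝ => functionalPath β' β'' μ p.1 p.2 :=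
  ((measurable_holderFunctional β' β'' μ).comp
    (measurable_shift_uncurry.comp measurable_swap)).ennreal_toReal

theorem measurable_integral_functionalPath [TopologicalSpace.SeparableSpace V] (a b : ℝ) :
    Measurable fun ω : PathSpace V => ∫ q in a..b, functionalPath β' β'' μ ω q := by
  have h := (measurable_functionalPath_uncurry (V := V) (β' := β') (β'' := β'') (μ := μ))
    |>.stronglyMeasurable
  simp only [intervalIntegral]
  exact (h.integral_prod_right (ν := volume.restrict (Ioc a b))).measurable.sub
    (h.integral_prod_right (ν := volume.restrict (Ioc b a))).measurable

theorem measurableSet_goodPaths [TopologicalSpace.SeparableSpace V] (hβ : β' < β'') (hμ : 0 < μ)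
    (P : Measure (PathSpace V)) : MeasurableSet (goodPaths β' β'' μ P) := by
  rw [goodPaths_eq hβ hμ]
  refine measurableSet_holderPaths.inter (((measurableSet_tendsto _ fun n => ?_).inter
    (measurableSet_tendsto _ fun n => ?_)).inter ((measurableSet_tendsto _ fun n => ?_).inter
    (measurableSet_tendsto _ fun n => ?_)))
  · exact (measurable_integral_functionalPath _ _).div_const _
  · exact (measurable_integral_functionalPath _ _).div_const _
  · exact ((measurable_windowSeminorm _).comp (measurable_shift _)).div_const _
  · exact ((measurable_windowSeminorm _).comp (measurable_shift _)).div_const _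

theorem shift_mem_holderPaths (hω : ω ∈ holderPaths β'') (t : ℝ) :
    shift t ω ∈ holderPaths β'' := fun k => by
  rw [holderSeminorm_shift]
  exact holderSeminorm_lt_top hω _ _

theorem tendsto_const_add_of_mem {l : Filter ℝ} (hl : l ∈ ({atTop, atBot} : Set (Filter ℝ)))
    (t : ℝ) : Tendsto (fun s => t + s) l l := by
  rcases hl with rfl | rfl
  · exact tendsto_atTop_add_const_left _ _ tendsto_id
  · exact tendsto_atBot_add_const_left _ _ tendsto_id

theorem tendsto_inv_of_mem {l : Filter ℝ} (hl : l ∈ ({atTop, atBot} : Set (Filter ℝ))) :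
    Tendsto (fun s : ℝ => s⁻¹) l (𝓝 0) := by
  rcases hl with rfl | rfl
  · exact tendsto_inv_atTop_zero
  · exact tendsto_inv_atBot_zero

theorem tendsto_abs_of_mem {l : Filter ℝ} (hl : l ∈ ({atTop, atBot} : Set (Filter ℝ))) :
    Tendsto (fun s : ℝ => |s|) l atTop := by
  rcases hl with rfl | rfl
  · exact tendsto_abs_atTop_atTop
  · exact tendsto_abs_atBot_atTop

theorem shift_mem_sublinearPaths (hω : ω ∈ sublinearPaths β'') (t : ℝ) :
    shift t ω ∈ sublinearPaths β'' := fun l hl => by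
  have h1 := ENNReal.Tendsto.const_mul ((hω l hl).comp (tendsto_const_add_of_mem hl t))
    (Or.inr (by norm_num : (2 : ℝ≥0∞) ≠ ∞))
  rw [mul_zero] at h1
  refine tendsto_of_tendsto_of_tendsto_of_le_of_le' tendsto_const_nhds h1
    (.of_forall fun _ => zero_le) ?_
  filter_upwards [(tendsto_abs_of_mem hl).eventually_ge_atTop |t|] with s hs
  simp only [Function.comp_apply, shift_shift]
  have h2 : ENNReal.ofReal |t + s| ≤ 2 * ENNReal.ofReal |s| := by
    rw [show (2 : ℝ≥0∞) = ENNReal.ofReal 2 by simp, ← ENNReal.ofReal_mul (by norm_num)]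
    exact ENNReal.ofReal_le_ofReal (by linarith [abs_add_le t s])
  calc windowSeminorm β'' (shift (t + s) ω) / ENNReal.ofReal |s|
      = 2 * (windowSeminorm β'' (shift (t + s) ω) / (2 * ENNReal.ofReal |s|)) := by
        rw [← mul_div_assoc, ENNReal.mul_div_mul_left _ _ (by norm_num) (by norm_num)]
    _ ≤ _ := by gcongr

/-- The shifted integral differs from the one up to `t + s` by a term independent of `s`, and `(t +
s) / s → 1`. -/
theorem shift_mem_ergodicPaths {P : Measure (PathSpace V)} (hβ : β' < β'') (hμ : 0 < μ)
    (hω : ω ∈ ergodicPaths β' β'' μ P) (hω' : ω ∈ holderPaths β'') (t : ℝ) :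
    shift t ω ∈ ergodicPaths β' β'' μ P := fun l hl => by
  have hI := intervalIntegrable_functionalPath hβ hμ hω'
  have h1 := (hω l hl).comp (tendsto_const_add_of_mem hl t)
  have hinv := tendsto_inv_of_mem hl
  have h2 : Tendsto (fun s : ℝ => 1 + t * s⁻¹) l (𝓝 1) := by
    simpa using (hinv.const_mul t).const_add 1
  have h3 := (h2.mul h1).sub (hinv.mul_const (∫ q in (0 : ℝ)..t, functionalPath β' β'' μ ω q))
  rw [one_mul, zero_mul, sub_zero] at h3
  refine h3.congr' ?_
  filter_upwards [(tendsto_abs_of_mem hl).eventually_gt_atTop |t|] with s hs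
  have hs0 : s ≠ 0 := by
    rintro rfl
    simp only [abs_zero] at hs
    linarith [abs_nonneg t]
  have hts : t + s ≠ 0 := by
    intro h
    rw [show t = -s by linarith, abs_neg] at hs
    exact lt_irrefl _ hs
  have e : ∫ q in (0 : ℝ)..s, (holderFunctional β' β'' μ (shift q (shift t ω))).toReal =
      (∫ q in (0 : ℝ)..(t + s), functionalPath β' β'' μ ω q) -
        ∫ q in (0 : ℝ)..t, functionalPath β' β'' μ ω q := by
    rw [intervalIntegral.integral_interval_sub_left (hI _ _) (hI _ _)]
    simp_rw [shift_shift]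
    rw [intervalIntegral.integral_comp_add_left
      (fun q => (holderFunctional β' β'' μ (shift q ω)).toReal), add_zero]
    rfl
  simp only [Function.comp_apply]
  rw [e]
  change (1 + t * s⁻¹) * (1 / (t + s) * ∫ q in (0 : ℝ)..(t + s), functionalPath β' β'' μ ω q) -
    _ = _
  field_simp
  ring

theorem shift_preimage_goodPaths (hβ : β' < β'') (hμ : 0 < μ) (P : Measure (PathSpace V))
    (t : ℝ) : shift t ⁻¹' goodPaths β' β'' μ P = goodPaths β' β'' μ P := by
  have h : ∀ (t : ℝ) (ω : PathSpace V), ω ∈ goodPaths β' β'' μ P →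
      shift t ω ∈ goodPaths β' β'' μ P := fun t ω hω =>
    ⟨⟨shift_mem_ergodicPaths hβ hμ hω.1.1 hω.2 t, shift_mem_sublinearPaths hω.1.2 t⟩,
      shift_mem_holderPaths hω.2 t⟩
  ext ω
  refine ⟨fun hω => ?_, h t ω⟩
  simpa [shift_shift] using h (-t) _ hω

end GoodPaths

/-! ### The mean of the functional and choice of exponents. -/

section Mean

variable {V : Type*} [NormedAddCommGroup V] {β' β'' μ : ℝ} {P : Measure (PathSpace V)}

theorem one_le_holderFunctional (hβ : β' < β'') (hμ : 0 < μ) (ω : PathSpace V) :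
    1 ≤ holderFunctional β' β'' μ ω := by
  refine ENNReal.one_le_rpow ?_ (one_div_pos.2 (sub_pos.2 hβ))
  rw [ENNReal.le_div_iff_mul_le (Or.inl (by simpa using hμ)) (Or.inl ENNReal.ofReal_ne_top),
    one_mul]
  exact le_add_self

theorem one_le_toReal_holderMean [IsProbabilityMeasure P] (hβ : β' < β'') (hμ : 0 < μ)
    (h : holderMean β' β'' μ P < ∞) : 1 ≤ (holderMean β' β'' μ P).toReal := by
  rw [← ENNReal.toReal_one]
  refine ENNReal.toReal_mono h.ne ?_
  calc (1 : ℝ≥0∞) = ∫⁻ _, 1 ∂P := by simp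
    _ ≤ _ := lintegral_mono fun ω => one_le_holderFunctional hβ hμ ω

theorem integral_functionalPath_shift (ω : PathSpace V) (t a b : ℝ) :
    ∫ q in a..b, functionalPath β' β'' μ (shift t ω) q =
      ∫ q in (t + a)..(t + b), functionalPath β' β'' μ ω q := by
  simp_rw [functionalPath_shift]
  exact intervalIntegral.integral_comp_add_left (functionalPath β' β'' μ ω) t

/-- `1 < a * p` serves chaining, `b ≤ p` dominates the power in `F`, and `2 ≤ p` makes `∑ n ^ (-p)`
converge. -/
theorem exists_large_exponent {a : ℝ} (ha : 0 < a) (b : ℝ) : ∃ p : ℝ, 1 < a * p ∧ b ≤ p ∧ 2 ≤ p :=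
  ⟨max (max b 2) (2 / a), by
    have := mul_le_mul_of_nonneg_left (le_max_right (max b 2) (2 / a)) ha.le
    rw [mul_div_cancel₀ _ ha.ne'] at this
    linarith, (le_max_left _ _).trans (le_max_left _ _), (le_max_right _ _).trans (le_max_left _ _)⟩

end Mean

/-! ### The good set has full measure. -/

section FullMeasure

variable {V : Type*} [NormedAddCommGroup V] [InnerProductSpace ℝ V] [CompleteSpace V]
  [TopologicalSpace.SeparableSpace V] {H β' β'' μ : ℝ} {Q : V →L[ℝ] V} {P : Measure (PathSpace V)}
  [IsProbabilityMeasure P]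

theorem IsFBMLaw.lintegral_windowSeminorm_rpow_lt_top (hP : IsFBMLaw H Q P) {γ p : ℝ}
    (hγ : 0 < γ) (hγH : γ < H) (hp0 : 0 ≤ p) (hp : 1 < (H - γ) * p) :
    ∫⁻ ω, windowSeminorm γ ω ^ p ∂P < ∞ :=
  (lintegral_mono fun ω => ENNReal.rpow_le_rpow (windowSeminorm_le γ ω) hp0).trans_lt
    (hP.lintegral_holderSeminorm_rpow_lt_top hγ hγH hp (by norm_num))

/-- The base of the power in `F` is at least 1, so the exponent may be raised to a `p` for which the
window seminorm has a finite moment. -/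
theorem IsFBMLaw.holderMean_lt_top (hP : IsFBMLaw H Q P) (hβ0 : 0 < β'')
    (hβH : β'' < H) (hμ : 0 < μ) : holderMean β' β'' μ P < ∞ := by
  obtain ⟨p, hp, hpb, hp2⟩ := exists_large_exponent (sub_pos.2 hβH) (1 / (β'' - β'))
  have hp0 : 0 ≤ p := by linarith
  have hμ0 : ENNReal.ofReal μ ≠ 0 := by simpa using hμ
  have hbound : ∀ ω : PathSpace V, holderFunctional β' β'' μ ω ≤
      (2 ^ (p - 1) * windowSeminorm β'' ω ^ p + 2 ^ (p - 1) * ENNReal.ofReal μ ^ p) *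
        (ENNReal.ofReal μ ^ p)⁻¹ := fun ω => by
    have h1 : 1 ≤ (windowSeminorm β'' ω + ENNReal.ofReal μ) / ENNReal.ofReal μ := by
      rw [ENNReal.le_div_iff_mul_le (Or.inl hμ0) (Or.inl ENNReal.ofReal_ne_top), one_mul]
      exact le_add_self
    calc holderFunctional β' β'' μ ω
        ≤ ((windowSeminorm β'' ω + ENNReal.ofReal μ) / ENNReal.ofReal μ) ^ p :=
          ENNReal.rpow_le_rpow_of_exponent_le h1 hpb
      _ = (windowSeminorm β'' ω + ENNReal.ofReal μ) ^ p * (ENNReal.ofReal μ ^ p)⁻¹ := by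
          rw [ENNReal.div_rpow_of_nonneg _ _ hp0, div_eq_mul_inv]
      _ ≤ _ := by
          gcongr
          rw [← mul_add]
          exact ENNReal.rpow_add_le_mul_rpow_add_rpow _ _ (by linarith)
  have hc : (ENNReal.ofReal μ ^ p)⁻¹ ≠ ∞ := by
    rw [ENNReal.inv_ne_top]
    exact (ENNReal.rpow_pos (pos_iff_ne_zero.2 hμ0) ENNReal.ofReal_ne_top).ne'
  have hc2 : (2 : ℝ≥0∞) ^ (p - 1) ≠ ∞ := ENNReal.rpow_ne_top_of_nonneg (by linarith) (by norm_num)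
  refine (lintegral_mono hbound).trans_lt ?_
  rw [lintegral_mul_const' _ _ hc, lintegral_add_right _ measurable_const,
    lintegral_const_mul' _ _ hc2, lintegral_const, measure_univ, mul_one]
  exact ENNReal.mul_lt_top (ENNReal.add_lt_top.2 ⟨ENNReal.mul_lt_top hc2.lt_top
    (hP.lintegral_windowSeminorm_rpow_lt_top hβ0 hβH hp0 hp), ENNReal.mul_lt_top hc2.lt_top
    (ENNReal.rpow_lt_top_of_nonneg hp0 ENNReal.ofReal_ne_top)⟩) hc.lt_top

theorem IsFBMLaw.ae_mem_holderPaths (hP : IsFBMLaw H Q P) (hβ0 : 0 < β'') (hβH : β'' < H) :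
    ∀ᵐ ω ∂P, ω ∈ holderPaths β'' := by
  obtain ⟨p, hp, -, hp2⟩ := exists_large_exponent (sub_pos.2 hβH) 0
  have hp0 : 0 < p := by linarith
  refine ae_all_iff.2 fun k => ?_
  -- Enlarging by 1 keeps the interval nondegenerate when `k = 0`.
  have h1 : ∀ᵐ ω ∂P, holderSeminorm β'' (-((k : ℝ) + 1)) (k + 1) ω ^ p < ∞ :=
    ae_lt_top ((measurable_holderSeminorm _ _ _).pow_const p)
      (hP.lintegral_holderSeminorm_rpow_lt_top hβ0 hβH hp (by linarith [k.cast_nonneg (α := ℝ)])).ne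
  filter_upwards [h1] with ω hω
  refine (holderSeminorm_mono ω (by linarith) (by linarith)).trans_lt
    ((ENNReal.rpow_lt_top_iff_of_pos hp0).1 hω)

/-- Sublinear growth of the window seminorm along integer times. -/
theorem IsFBMLaw.ae_tendsto_windowSeminorm_div (hP : IsFBMLaw H Q P) (hβ0 : 0 < β'')
    (hβH : β'' < H) (σ : ℝ) :
    ∀ᵐ ω ∂P, Tendsto (fun n : ℕ => windowSeminorm β'' (shift (σ * n) ω) / n) atTop (𝓝 0) := by
  obtain ⟨p, hp, -, hp2⟩ := exists_large_exponent (sub_pos.2 hβH) 0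
  have hp0 : 0 < p := by linarith
  set M := ∫⁻ ω, windowSeminorm β'' ω ^ p ∂P with hM
  have hMtop : M < ∞ := hP.lintegral_windowSeminorm_rpow_lt_top hβ0 hβH hp0.le hp
  have hmeas : ∀ n : ℕ, Measurable fun ω : PathSpace V =>
      (windowSeminorm β'' (shift (σ * (n + 1 : ℕ)) ω) / (n + 1 : ℕ)) ^ p := fun n =>
    (((measurable_windowSeminorm _).comp (measurable_shift _)).div_const _).pow_const p
  have hint : ∀ n : ℕ, ∫⁻ ω, (windowSeminorm β'' (shift (σ * (n + 1 : ℕ)) ω) / (n + 1 : ℕ)) ^ p ∂P =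
      M * ENNReal.ofReal (1 / ((n + 1 : ℕ) : ℝ) ^ p) := fun n => by
    have h1 := (hP.measurePreserving_shift (hβ0.trans hβH) (σ * (n + 1 : ℕ))).lintegral_comp
      ((measurable_windowSeminorm (V := V) β'').pow_const p)
    rw [hM, ← h1, ← lintegral_mul_const' _ _ ENNReal.ofReal_ne_top]
    refine lintegral_congr fun ω => ?_
    rw [ENNReal.div_rpow_of_nonneg _ _ hp0.le, div_eq_mul_inv, one_div,
      ENNReal.ofReal_inv_of_pos (by positivity), ← ENNReal.ofReal_rpow_of_nonneg (by positivity)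
      hp0.le, ENNReal.ofReal_natCast]
  -- By stationarity the `p`-th moments are `M / (n + 1) ^ p`, so the series of `p`-th powers is
  -- almost surely finite and its terms vanish.
  have hsum : ∫⁻ ω, ∑' n : ℕ, (windowSeminorm β'' (shift (σ * (n + 1 : ℕ)) ω) /
      (n + 1 : ℕ)) ^ p ∂P < ∞ := by
    rw [lintegral_tsum fun n => (hmeas n).aemeasurable]
    simp_rw [hint]
    rw [ENNReal.tsum_mul_left]
    refine ENNReal.mul_lt_top hMtop ?_
    have hs : Summable fun n : ℕ => 1 / ((n + 1 : ℕ) : ℝ) ^ p :=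
      (summable_nat_add_iff 1).2 (Real.summable_one_div_nat_rpow.2 (by linarith))
    rw [← ENNReal.ofReal_tsum_of_nonneg (fun n => by positivity) hs]
    exact ENNReal.ofReal_lt_top
  filter_upwards [ae_lt_top (Measurable.tsum hmeas) hsum.ne] with ω hω
  have h1 := ENNReal.tendsto_atTop_zero_of_tsum_ne_top hω.ne
  have h2 := (ENNReal.continuous_rpow_const (y := p⁻¹)).tendsto 0 |>.comp h1
  rw [ENNReal.zero_rpow_of_pos (inv_pos.2 hp0)] at h2
  refine (tendsto_add_atTop_iff_nat 1).1 (h2.congr fun n => ?_)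
  simp only [Function.comp_apply]
  rw [ENNReal.rpow_rpow_inv hp0.ne']

theorem IsFBMLaw.lintegral_functional_shift (hP : IsFBMLaw H Q P) (hH : 0 < H) (q : ℝ) :
    ∫⁻ ω, holderFunctional β' β'' μ (shift q ω) ∂P = holderMean β' β'' μ P :=
  (hP.measurePreserving_shift hH q).lintegral_comp (measurable_holderFunctional β' β'' μ)

theorem IsFBMLaw.integrable_uncurry_functionalPath (hP : IsFBMLaw H Q P) (hH : 0 < H)
    (hm : holderMean β' β'' μ P < ∞) (a b : ℝ) :
    Integrable (fun p : PathSpace V × ℝ => functionalPath β' β'' μ p.1 p.2)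
      (P.prod (volume.restrict (Ioc a b))) := by
  refine ⟨measurable_functionalPath_uncurry.aestronglyMeasurable, ?_⟩
  rw [hasFiniteIntegral_iff_enorm,
    lintegral_prod_symm _ measurable_functionalPath_uncurry.enorm.aemeasurable]
  have hle : ∀ q : ℝ, ∫⁻ ω : PathSpace V, ‖functionalPath β' β'' μ ω q‖ₑ ∂P ≤
      holderMean β' β'' μ P := fun q => by
    rw [← hP.lintegral_functional_shift hH q]
    refine lintegral_mono fun ω => ?_
    rw [functionalPath, Real.enorm_of_nonneg ENNReal.toReal_nonneg]
    exact ENNReal.ofReal_toReal_le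
  refine (lintegral_mono hle).trans_lt ?_
  rw [lintegral_const]
  exact ENNReal.mul_lt_top hm (by simp)

/-- Fubini and stationarity: this identifies the constant produced by the ergodic theorem. -/
theorem IsFBMLaw.integral_integral_functionalPath (hP : IsFBMLaw H Q P) (hH : 0 < H)
    (hm : holderMean β' β'' μ P < ∞) (a : ℝ) :
    ∫ ω, (∫ q in a..(a + 1), functionalPath β' β'' μ ω q) ∂P = (holderMean β' β'' μ P).toReal := by
  have hi := hP.integrable_uncurry_functionalPath hH hm a (a + 1)
  simp_rw [intervalIntegral.integral_of_le (show a ≤ a + 1 by linarith)]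
  rw [integral_integral_swap hi]
  have hE : ∀ q : ℝ, ∫ ω : PathSpace V, functionalPath β' β'' μ ω q ∂P =
      (holderMean β' β'' μ P).toReal := fun q => by
    have hmq : Measurable fun ω : PathSpace V => holderFunctional β' β'' μ (shift q ω) :=
      (measurable_holderFunctional β' β'' μ).comp (measurable_shift q)
    have h1 := hP.lintegral_functional_shift (β' := β') (β'' := β'') (μ := μ) hH q
    rw [← h1]
    exact integral_toReal hmq.aemeasurable (ae_lt_top hmq (by rw [h1]; exact hm.ne))
  simp_rw [hE]
  simp

theorem IsFBMLaw.integrable_integral_functionalPath (hP : IsFBMLaw H Q P) (hH : 0 < H)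
    (hm : holderMean β' β'' μ P < ∞) (a : ℝ) :
    Integrable (fun ω => ∫ q in a..(a + 1), functionalPath β' β'' μ ω q) P := by
  simp_rw [intervalIntegral.integral_of_le (show a ≤ a + 1 by linarith)]
  exact (hP.integrable_uncurry_functionalPath hH hm a (a + 1)).integral_prod_left

/-- Birkhoff sums of the integral over `[0, 1]` under the unit shift are the integrals over `[0,
n]`. -/
theorem IsFBMLaw.ae_tendsto_forward_average (hP : IsFBMLaw H Q P) (hβ : β' < β'') (hβ0 : 0 < β'')
    (hβH : β'' < H) (hH : H < 1) (hμ : 0 < μ) :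
    ∀ᵐ ω ∂P, Tendsto (fun n : ℕ => (∫ q in (0 : ℝ)..n, functionalPath β' β'' μ ω q) / n) atTop
      (𝓝 (holderMean β' β'' μ P).toReal) := by
  have hH0 := hβ0.trans hβH
  have hm := hP.holderMean_lt_top (β' := β') hβ0 hβH hμ
  filter_upwards [hP.ae_mem_holderPaths hβ0 hβH, ae_tendsto_birkhoffSum_div
    (hP.ergodic_shift_one hH0 hH) (measurable_integral_functionalPath 0 (0 + 1))
    (hP.integrable_integral_functionalPath hH0 hm 0)] with ω hω h
  rw [hP.integral_integral_functionalPath hH0 hm] at h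
  refine h.congr fun n => ?_
  congr 1
  have := intervalIntegral.sum_integral_adjacent_intervals (n := n) (a := fun k : ℕ => (k : ℝ))
    (fun k _ => intervalIntegrable_functionalPath hβ hμ hω (k : ℝ) (k + 1 : ℕ))
  rw [Nat.cast_zero] at this
  rw [← this]
  refine Finset.sum_congr rfl fun k _ => ?_
  rw [iterate_shift_one]
  beta_reduce
  rw [integral_functionalPath_shift]
  simp

/-- The same with the inverse shift and the integral over `[-1, 0]`. -/
theorem IsFBMLaw.ae_tendsto_backward_average (hP : IsFBMLaw H Q P) (hβ : β' < β'')
    (hβ0 : 0 < β'') (hβH : β'' < H) (hH : H < 1) (hμ : 0 < μ) :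
    ∀ᵐ ω ∂P, Tendsto (fun n : ℕ => (∫ q in (-n : ℝ)..0, functionalPath β' β'' μ ω q) / n) atTop
      (𝓝 (holderMean β' β'' μ P).toReal) := by
  have hH0 := hβ0.trans hβH
  have hm := hP.holderMean_lt_top (β' := β') hβ0 hβH hμ
  filter_upwards [hP.ae_mem_holderPaths hβ0 hβH, ae_tendsto_birkhoffSum_div
    (hP.ergodic_shift_neg_one hH0 hH) (measurable_integral_functionalPath (-1) (-1 + 1))
    (hP.integrable_integral_functionalPath hH0 hm (-1))] with ω hω h
  rw [hP.integral_integral_functionalPath hH0 hm] at h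
  refine h.congr fun n => ?_
  congr 1
  have := intervalIntegral.sum_integral_adjacent_intervals (n := n) (a := fun k : ℕ => -(k : ℝ))
    (fun k _ => intervalIntegrable_functionalPath hβ hμ hω (-(k : ℝ)) (-((k + 1 : ℕ) : ℝ)))
  rw [Nat.cast_zero, neg_zero] at this
  rw [intervalIntegral.integral_symm, ← this, ← Finset.sum_neg_distrib]
  refine Finset.sum_congr rfl fun k _ => ?_
  rw [iterate_shift_neg_one]
  beta_reduce
  rw [integral_functionalPath_shift, ← intervalIntegral.integral_symm]
  congr 1
  · push_cast
    ring
  · ring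

theorem IsFBMLaw.measure_goodPaths (hP : IsFBMLaw H Q P) (hβ : β' < β'') (hβ0 : 0 < β'')
    (hβH : β'' < H) (hH : H < 1) (hμ : 0 < μ) : P (goodPaths β' β'' μ P) = 1 := by
  rw [← prob_compl_eq_zero_iff (measurableSet_goodPaths hβ hμ P)]
  change ∀ᵐ ω ∂P, ω ∈ goodPaths β' β'' μ P
  rw [goodPaths_eq hβ hμ]
  filter_upwards [hP.ae_mem_holderPaths hβ0 hβH,
    hP.ae_tendsto_forward_average hβ hβ0 hβH hH hμ,
    hP.ae_tendsto_backward_average hβ hβ0 hβH hH hμ,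
    hP.ae_tendsto_windowSeminorm_div hβ0 hβH 1,
    hP.ae_tendsto_windowSeminorm_div hβ0 hβH (-1)] with ω h1 h2 h3 h4 h5
  simp only [one_mul] at h4
  simp only [neg_one_mul] at h5
  exact ⟨h1, ⟨h2, h3⟩, h4, h5⟩

end FullMeasure

end FBMStopping

theorem mainTheorem6 {V : Type*} [NormedAddCommGroup V] [InnerProductSpace ℝ V] [CompleteSpace V]
    [TopologicalSpace.SeparableSpace V]
    (H β β' β'' μ : ℝ) (hβ : 1 / 2 < β) (hβ' : β < β') (hβ'' : β' < β'') (hβH : β'' < H)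
    (hH : H < 1) (hμ : 0 < μ)
    (Q : V →L[ℝ] V) (hQ : FBMStopping.IsPositiveTraceClass Q)
    (P : Measure (FBMStopping.PathSpace V)) [IsProbabilityMeasure P]
    (hP : FBMStopping.IsFBMLaw H Q P) :
    -- `Ω` is measurable, invariant under the shift flow, and of full measure
    MeasurableSet (FBMStopping.goodPaths β' β'' μ P) ∧
    (∀ t : ℝ, FBMStopping.shift t ⁻¹' FBMStopping.goodPaths β' β'' μ P =
      FBMStopping.goodPaths β' β'' μ P) ∧
    P (FBMStopping.goodPaths β' β'' μ P) = 1 ∧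
    -- the expectation defining `1 / d` is finite, and `d > 0`
    FBMStopping.holderMean β' β'' μ P < ∞ ∧
    0 < FBMStopping.rate β' β'' μ P ∧
    ∀ ω ∈ FBMStopping.goodPaths β' β'' μ P,
      ((FBMStopping.rate β' β'' μ P : ℝ) : EReal) ≤
        liminf (fun k : ℤ => ((FBMStopping.stoppingTime β' μ k ω / (k : ℝ) : ℝ) : EReal)) atBot ∧
      (∀ i : ℤ, 0 < FBMStopping.forwardTime β' μ
        (FBMStopping.shift (FBMStopping.stoppingTime β' μ i ω) ω)) ∧
      Tendsto (fun i : ℤ =>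
        Real.posLog (|FBMStopping.forwardTime β' μ
          (FBMStopping.shift (FBMStopping.stoppingTime β' μ i ω) ω)| ^ (-β)) / |(i : ℝ)|)
        atBot (𝓝 0) := by
  have hβ0 : 0 < β'' := by linarith
  have hβ1 : β'' < 1 := by linarith
  have hm := hP.holderMean_lt_top (β' := β') hβ0 hβH hμ
  -- Finiteness matters: `toReal` sends `∞` to `0`, which would make `rate` vanish.
  have hm1 := FBMStopping.one_le_toReal_holderMean hβ'' hμ hm
  refine ⟨FBMStopping.measurableSet_goodPaths hβ'' hμ P,
    FBMStopping.shift_preimage_goodPaths hβ'' hμ P,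
    hP.measure_goodPaths hβ'' hβ0 hβH hH hμ, hm, inv_pos.2 (by linarith), fun ω hω => ⟨?_, ?_, ?_⟩⟩
  · exact FBMStopping.inv_le_liminf_stoppingTime hβ'' hβ1 hμ hω.2 (by linarith)
      (hω.1.1 atBot (by simp))
  · exact fun i => FBMStopping.forwardTime_shift_pos hβ'' hβ1 hμ hω.2 _
  · exact FBMStopping.tendsto_posLog_forwardTime (by linarith) hβ'' hβ1 hμ hω.2
      (hω.1.2 atBot (by simp))
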